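/- **Setting.** Let $J\ge 1$, let $\mathcal X\subseteq\mathbb R^J$ be open and connected, and let $\mathcal R=\{0,1,\dots,\bar R\}$. A model consists of random variables $X\in\mathcal X$, $U\in\mathbb R$, $V\in\mathcal V$, a function $g:\mathcal X\to\mathbb R$, a set $\mathcal H\subseteq\mathbb R$ of possible latent outcomes and a reporting function $r:\mathcal H\times\mathcal V\to\mathcal R$; the latent outcome is $H=h(X,U)=g(X)+U\in\mathcal H$ and the response is $R=r(H,V)$. There are no controls. Only $(R,X)$ is observed. Write $F(\cdot\,|x,v)$, $Q(\cdot\,|x,v)$ and $f(\cdot\,|x,v)$ for the conditional distribution function, quantile function and density of $H$ given $X=x,V=v$, and $\tau_v(\rho)=\sup\{h\in\mathcal H: r(h,v)\le \rho\}\in[-\infty,\infty]$ for the reporting thresholds. Assume: * (HONEST) $r(\cdot,v)$ is weakly increasing and left-continuous on $\mathcal H$ for every $v$. * (EXOG) The vector $X$ is independent of $V$, and $X$ is independent of $U$ conditionally on $V$. * (REG, for every $j=1,\dots,J$) $X_j$ has a density; for all $x\in\mathcal X$ and $v\in\mathcal V$ the function $F(\cdot\,|x,v)$ is differentiable on $\mathbb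 R$, with derivative $f(\cdot\,|x,v)$; the partial derivative $\partial_{x_j}Q(\alpha|x,v)$ exists and is at most a constant $B<\infty$ for all $\alpha\in(0,1)$, $x\in\mathcal X$, $v\in\mathcal V$; and for each $x\in\mathcal X$ the density $f(h|x,v)$ is bounded above uniformly in $h$ and $v$. * $g$ is continuously differentiable on $\mathcal X$; it is homogeneous of degree one, i.e. $g(tx)=t\,g(x)$ whenever $t>0$ and $x,tx\in\mathcal X$; and for some $k$, $\partial_{x_k}g(x)\ne0$ for all $x\in\mathcal X$. * Every point of $\mathcal X$ is in the support of $X$, and for every $x\in\mathcal X$ the weight $\sum_{\rho<\bar R} f(\tau_V(\rho)|x,V)$ is positive with positive probability (with $f(\pm\infty|x,v)=0$). **Claim.** The regression function $m(x)=E[R|X=x]$ has exactly one continuous version on $\mathcal X$, and this version is differentiable on $\mathcal X$. For every $k$ such that $\partial_{x_k}g$ vanishes nowhere on $\mathcal X$, also $\partial_{x_k}m$ vanishes nowhere on $\mathcal X$, and for all $x\in\mathcal X$ and all $j$, $$\frac{\partial_{x_j}g(x)}{\partial_{x_k}g(x)}=\frac{\partial_{x_j}m(x)}{\partial_{x_k}m(x)}=:\rho_j(x),\qquad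 \frac{g(x)}{\partial_{x_k}g(x)}=x_k+\sum_{l\ne k}\rho_l(x)\,x_l=:D(x).$$ If $\gamma:[0,1]\to\mathcal X\cap\{g\ne0\}$ is continuous, differentiable off a countable set, and has integrable derivative (for instance if $\gamma$ is piecewise $C^1$), and $\gamma(0)=x^*$, $\gamma(1)=x$, then the integrand below is integrable and $$g(x)=g(x^*)\exp\Big(\int_0^1\sum_{j=1}^J\frac{\rho_j(\gamma(t))}{D(\gamma(t))}\,\gamma_j'(t)\,dt\Big).$$ In particular, if the points $p_j(t)=(x_1,\dots,x_{j-1},t,x^*_{j+1},\dots,x^*_J)$, for $t$ between $x_j^*$ and $x_j$ and $j=1,\dots,J$, all lie in $\mathcal X\cap\{g\ne0\}$, then the integrands below are integrable and $$g(x)=g(x^*)\exp\Big(\sum_{j=1}^J\int_{x_j^*}^{x_j}\frac{\rho_j(p_j(t))}{D(p_j(t))}\,dt\Big).$$ Hence $g$ is identified up to scale: if two models on the same $\mathcal X$ and $\mathcal R$, with structural functions $g(x)+u$ and $\tilde g(x)+u$, both satisfy all the assumptions and generate the same joint distribution of $(R,X)$, then there is a constant $c>0$ with $\tilde g(x)=c\,g(x)$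 for all $x\in\mathcal X$. -/

import Mathlib

open MeasureTheory ProbabilityTheory Set

noncomputable section

namespace OrderedResponse

/-- The space `ℝ^J` of covariate vectors. -/
abbrev Cov (J : ℕ) : Type := EuclideanSpace ℝ (Fin J)

/-- The partial derivative `∂_{x_j} f (x)`. -/
def partialD {J : ℕ} (f : Cov J → ℝ) (j : Fin J) (x : Cov J) : ℝ :=
  lineDeriv ℝ f x (EuclideanSpace.single j 1)

/-- The primitives of the ordered response model without controls, with structural function
`h(x,u) = g(x) + u`: latent outcome `H = g(X) + U`, response `R = r(H,V)`, with response categories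
`{0, …, Rbar}`; `D` is the set of possible covariate values, `latent` the set of possible values of
the latent outcome, and the type `𝒱` the set of possible types of reporting behaviour.
`kerH (x,v)` is the conditional distribution of `H` given `X = x` and `V = v`. -/
structure Model (J Rbar : ℕ) (D : Set (Cov J)) (Ω : Type*) [MeasurableSpace Ω]
    (𝒱 : Type*) [MeasurableSpace 𝒱] where
  μ : Measure Ω
  isProb : IsProbabilityMeasure μ
  X : Ω → Cov J
  U : Ω → ℝ
  V : Ω → 𝒱
  measurable_X : Measurable X
  measurable_U : Measurable U
  measurable_V : Measurable V
  X_mem : ∀ ω, X ω ∈ D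
  g : Cov J → ℝ
  latent : Set ℝ
  H_mem : ∀ ω, g (X ω) + U ω ∈ latent
  r : ℝ → 𝒱 → Fin (Rbar + 1)
  measurable_r : ∀ h ∈ latent, Measurable (r h)
  kerH : Kernel (Cov J × 𝒱) ℝ
  isMarkov : IsMarkovKernel kerH
  hasCondDistrib : HasCondDistrib (fun ω => g (X ω) + U ω) (fun ω => (X ω, V ω)) kerH μ

namespace Model

variable {J Rbar : ℕ} {D : Set (Cov J)} {Ω : Type*} [MeasurableSpace Ω]
  {𝒱 : Type*} [MeasurableSpace 𝒱]

instance (M : Model J Rbar D Ω 𝒱) : IsProbabilityMeasure M.μ := M.isProb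

/-- The latent outcome `H = h(X,U) = g(X) + U`. -/
def H (M : Model J Rbar D Ω 𝒱) (ω : Ω) : ℝ := M.g (M.X ω) + M.U ω

/-- The observed response `R = r(H,V)`. -/
def R (M : Model J Rbar D Ω 𝒱) (ω : Ω) : Fin (Rbar + 1) := M.r (M.H ω) (M.V ω)

/-- HONEST: each reporting function is weakly increasing and left-continuous on the set of
possible values of the latent outcome. -/
def Honest (M : Model J Rbar D Ω 𝒱) : Prop :=
  ∀ v : 𝒱, MonotoneOn (fun h => M.r h v) M.latent ∧
    ∀ h ∈ M.latent, ContinuousWithinAt (fun h' => M.r h' v) (M.latent ∩ Iic h) h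

/-- EXOG without controls: `X` is independent of `V`, and independent of `U` given `V`. -/
def Exog [StandardBorelSpace Ω] (M : Model J Rbar D Ω 𝒱) : Prop :=
  IndepFun M.X M.V M.μ ∧
    CondIndepFun (MeasurableSpace.comap M.V inferInstance) M.measurable_V.comap_le M.X M.U M.μ

/-- The conditional cdf `F_{H|XV}(h|x,v)`. -/
def condCdf (M : Model J Rbar D Ω 𝒱) (x : Cov J) (v : 𝒱) (h : ℝ) : ℝ :=
  cdf (M.kerH (x, v)) h

/-- The conditional quantile function `Q_{H|XV}(α|x,v)`, for `0 < α < 1`. -/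
def condQuantile (M : Model J Rbar D Ω 𝒱) (α : ℝ) (x : Cov J) (v : 𝒱) : ℝ :=
  sInf {h : ℝ | α ≤ M.condCdf x v h}

/-- The conditional density `f(h|x,v)`, the derivative of the conditional cdf. -/
def condDensity (M : Model J Rbar D Ω 𝒱) (x : Cov J) (v : 𝒱) (h : ℝ) : ℝ :=
  deriv (M.condCdf x v) h

/-- REG for the `j`-th covariate. As `∂_{x_j} h(x,U) = ∂_{x_j} g(x)` is not random, the bound on the
joint density of `H` and `∂_{x_j} h(x,U)` is a bound on the density of `H`. -/
structure Reg (M : Model J Rbar D Ω 𝒱) (j : Fin J) : Prop where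
  cov_continuous : M.μ.map (fun ω => M.X ω j) ≪ volume
  latent_continuous : ∀ x ∈ D, ∀ v : 𝒱, Differentiable ℝ (M.condCdf x v)
  quantile_deriv : ∃ B : ℝ, ∀ α ∈ Ioo (0 : ℝ) 1, ∀ x ∈ D, ∀ v : 𝒱,
    LineDifferentiableAt ℝ (fun y => M.condQuantile α y v) x (EuclideanSpace.single j 1) ∧
      partialD (fun y => M.condQuantile α y v) j x ≤ B
  density_bounded : ∀ x ∈ D, ∃ c : ℝ, ∀ (v : 𝒱) (h : ℝ), M.condDensity x v h ≤ c

/-- The threshold `τ_v(ρ) = sup {h : r(h,v) ≤ ρ}` (possibly infinite). -/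
def threshold (M : Model J Rbar D Ω 𝒱) (v : 𝒱) (ρ : Fin (Rbar + 1)) : EReal :=
  sSup ((fun h : ℝ => (h : EReal)) '' {h | h ∈ M.latent ∧ M.r h v ≤ ρ})

/-- `f(t|x,v)` for an extended real `t`, zero at `±∞`. -/
def condDensityE (M : Model J Rbar D Ω 𝒱) (x : Cov J) (v : 𝒱) (t : EReal) : ℝ :=
  if t = ⊥ ∨ t = ⊤ then 0 else M.condDensity x v t.toReal

/-- The weight `w(x,v) = ∑_{ρ < Rbar} f(τ_v(ρ)|x,v)`. -/
def weight (M : Model J Rbar D Ω 𝒱) (x : Cov J) (v : 𝒱) : ℝ :=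
  ∑ ρ : Fin Rbar, M.condDensityE x v (M.threshold v ρ.castSucc)

/-- Every covariate value in `D` is in the support of `X`. -/
def FullSupport (M : Model J Rbar D Ω 𝒱) : Prop :=
  ∀ x ∈ D, ∀ O ∈ nhds x, 0 < M.μ (M.X ⁻¹' O)

/-- At each covariate value the weights are not almost surely zero, that is, with positive
probability the latent outcome has positive density at one of the individual's thresholds. -/
def PositiveWeight (M : Model J Rbar D Ω 𝒱) : Prop :=
  ∀ x ∈ D, 0 < M.μ {ω | 0 < M.weight x (M.V ω)}

/-- `g` is continuously differentiable and homogeneous of degree one on `D`, and one of its partial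
derivatives vanishes nowhere on `D`. -/
structure Structural (M : Model J Rbar D Ω 𝒱) : Prop where
  contDiff : ContDiffOn ℝ 1 M.g D
  homogeneous : ∀ x ∈ D, ∀ t : ℝ, 0 < t → t • x ∈ D → M.g (t • x) = t * M.g x
  partial_ne_zero : ∃ k : Fin J, ∀ x ∈ D, partialD M.g k x ≠ 0

/-- All assumptions on the model. -/
structure Assumptions [StandardBorelSpace Ω] (M : Model J Rbar D Ω 𝒱) : Prop where
  honest : M.Honest
  exog : M.Exog
  reg : ∀ j, M.Reg j
  structural : M.Structural
  fullSupport : M.FullSupport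
  positiveWeight : M.PositiveWeight

/-- The joint distribution of the observables `(R, X)`. -/
def observedLaw (M : Model J Rbar D Ω 𝒱) : Measure (Fin (Rbar + 1) × Cov J) :=
  M.μ.map (fun ω => (M.R ω, M.X ω))

/-- `m(x) = E[R | X = x]` for `x ∈ D`: the continuous version of the conditional expectation. -/
def IsRegression (M : Model J Rbar D Ω 𝒱) (m : Cov J → ℝ) : Prop :=
  ContinuousOn m D ∧
    (fun ω => m (M.X ω)) =ᵐ[M.μ]
      M.μ[fun ω => ((M.R ω : ℕ) : ℝ) | MeasurableSpace.comap M.X inferInstance]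

end Model

/-- The ratio `∂_{x_j} m(x) / ∂_{x_k} m(x)`. -/
def ratio {J : ℕ} (m : Cov J → ℝ) (k j : Fin J) (x : Cov J) : ℝ :=
  partialD m j x / partialD m k x

/-- `x_k + ∑_{l ≠ k} x_l ∂_{x_l} m(x) / ∂_{x_k} m(x)`. -/
def eulerSum {J : ℕ} (m : Cov J → ℝ) (k : Fin J) (x : Cov J) : ℝ :=
  x k + ∑ l ∈ Finset.univ.erase k, ratio m k l x * x l

/-- The `j`-th partial derivative of `log g`, in terms of ratios of partial derivatives of `m`. -/
def logGrad {J : ℕ} (m : Cov J → ℝ) (k j : Fin J) (x : Cov J) : ℝ :=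
  ratio m k j x / eulerSum m k x

/-- `γ` is a path in `S`, with derivative `γ'`, from `a` to `b`: continuous on `[0,1]`,
differentiable off a countable set, with integrable derivative (as for piecewise `C¹` paths). -/
structure IsPath {J : ℕ} (S : Set (Cov J)) (a b : Cov J) (γ γ' : ℝ → Cov J) : Prop where
  source : γ 0 = a
  target : γ 1 = b
  mem : ∀ t ∈ Icc (0 : ℝ) 1, γ t ∈ S
  continuousOn : ContinuousOn γ (Icc 0 1)
  hasDerivAt : ∃ s : Set ℝ, s.Countable ∧ ∀ t ∈ Ioo (0 : ℝ) 1 \ s, HasDerivAt γ (γ' t) t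
  integrable : IntervalIntegrable γ' volume 0 1

/-- The point `(x_1, …, x_{j-1}, t, a_{j+1}, …, a_J)`. -/
def stair {J : ℕ} (a x : Cov J) (j : Fin J) (t : ℝ) : Cov J :=
  WithLp.toLp 2 (fun i => if i < j then x i else if i = j then t else a i)

end OrderedResponse

end

open MeasureTheory ProbabilityTheory Set

noncomputable section

namespace OrderedResponse

/-! Exogeneity makes the law of `H` given `X = x`, `V = v` the law of `U` given `V = v` translated
by `g x`. For a fixed type the conditional laws at two covariate values are therefore translates of
each other by the difference of `g`. Writing `E[R | X = x']` as a sum over `ρ` of `1 - P(H ≤ τ_V(ρ)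
| X = x')`, one sees `x'` only through the shift `g x' - g x`. Differentiating in the shift under
the integral over types gives `∇m(x) = E[w(x,V)] ∇g(x)`, with a positive factor
(`hasFDerivAt_meanResponse`, `meanWeight_pos`). Ratios of partial derivatives thus agree, Euler's
theorem turns them into `g / ∂_k g`, hence into `∇ log |g|`, and this is integrated along paths
avoiding the zeros of `g`.

The delicate point is that conditional laws are determined only almost everywhere, whereas the
derivative at `x` needs the translation property at every point near `x`. A partial derivative
bounded above on one side suffices to make the conditional quantiles jointly continuous in `x`
(`continuousAt_of_partialD_le`), and full support then upgrades the almost sure identity to all of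
`D` (`ae_kerH_shift`).

For two models with the same observables, `∇g̃ = L ∇g` with `L` the ratio of mean weights, and
Euler's theorem gives `g̃ = L g`. Where `g ≠ 0` the quotient rule yields `∇L = 0`. The zero set of
`g` is crossed in direction `e_k`, where `g` vanishes at most once on a segment and `L` is
continuous; connectedness finishes (`exists_const_of_fderiv_eq_smul`). -/

/-! ### Joint continuity from one-sided bounds on partial derivatives. -/

open Filter Topology in
-- Coordinates are moved one at a time, each by a small step that stays in `U`. With `r` a strict
-- order this yields a corner of `U` strictly beyond `x` in every coordinate.
lemma exists_mem_forall_rel_of_separately_open {ι : Type*} [Fintype ι] [DecidableEq ι]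
    {U : Set (ι → ℝ)} (hU : ∀ z ∈ U, ∀ i, ∀ᶠ t in 𝓝 (z i), Function.update z i t ∈ U)
    {r : ℝ → ℝ → Prop} (hr : ∀ a, ∃ᶠ t in 𝓝 a, r a t) {x : ι → ℝ} (hx : x ∈ U) :
    ∃ y ∈ U, ∀ i, r (x i) (y i) := by
  suffices h : ∀ s : Finset ι, ∃ y ∈ U, (∀ i ∈ s, r (x i) (y i)) ∧ ∀ i ∉ s, y i = x i by
    obtain ⟨y, hy, h1, -⟩ := h Finset.univ
    exact ⟨y, hy, fun i => h1 i (Finset.mem_univ i)⟩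
  intro s
  induction s using Finset.induction_on with
  | empty => exact ⟨x, hx, by simp, by simp⟩
  | insert i s his ih =>
    obtain ⟨y, hy, h1, h2⟩ := ih
    obtain ⟨t, ht, htU⟩ := ((hr (y i)).and_eventually (hU y hy i)).exists
    refine ⟨Function.update y i t, htU, ?_, ?_⟩
    · intro j hj
      rcases Finset.mem_insert.1 hj with rfl | hjs
      · rw [Function.update_self, ← h2 j his]; exact ht
      · rw [Function.update_of_ne (by intro h; subst h; exact his hjs)]; exact h1 j hjs
    · intro j hj
      rw [Finset.mem_insert, not_or] at hj
      rw [Function.update_of_ne hj.1]; exact h2 j hj.2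

lemma antitoneOn_pi_of_separately {ι : Type*} [Fintype ι] [DecidableEq ι] {I : ι → Set ℝ}
    {f : (ι → ℝ) → ℝ}
    (h : ∀ z ∈ univ.pi I, ∀ i, AntitoneOn (fun t => f (Function.update z i t)) (I i)) :
    AntitoneOn f (univ.pi I) := by
  intro y hy z hz hyz
  have key : ∀ s : Finset ι, f (s.piecewise z y) ≤ f y := by
    intro s
    induction s using Finset.induction_on with
    | empty => simp
    | insert i s his ih =>
      refine le_trans ?_ ih
      have hmem : s.piecewise z y ∈ univ.pi I := by
        intro j _
        by_cases hj : j ∈ s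
        · simpa [hj] using hz j (mem_univ j)
        · simpa [hj] using hy j (mem_univ j)
      have := h _ hmem i (hy i (mem_univ i)) (hz i (mem_univ i)) (hyz i)
      rw [Finset.piecewise_insert]
      convert this using 2
      rw [Function.eq_update_iff]
      simp [his]
  simpa using key Finset.univ

open Filter Topology in
/-- A function which is antitone and continuous in each variable separately is jointly
continuous. -/
lemma continuousAt_of_separately_antitone {ι : Type*} [Fintype ι] [DecidableEq ι]
    {I : ι → Set ℝ} (hI : ∀ i, IsOpen (I i)) {f : (ι → ℝ) → ℝ}
    (h : ∀ z ∈ univ.pi I, ∀ i, AntitoneOn (fun t => f (Function.update z i t)) (I i))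
    (hc : ∀ z ∈ univ.pi I, ∀ i, ContinuousAt (fun t => f (Function.update z i t)) (z i))
    {x : ι → ℝ} (hx : x ∈ univ.pi I) : ContinuousAt f x := by
  have hanti := antitoneOn_pi_of_separately h
  have sep : ∀ W : Set ℝ, IsOpen W → ∀ z ∈ univ.pi I ∩ f ⁻¹' W, ∀ i,
      ∀ᶠ t in 𝓝 (z i), Function.update z i t ∈ univ.pi I ∩ f ⁻¹' W := by
    intro W hW z hz i
    have h1 : ∀ᶠ t in 𝓝 (z i), t ∈ I i := (hI i).mem_nhds (hz.1 i (mem_univ i))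
    have h2 : ∀ᶠ t in 𝓝 (z i), f (Function.update z i t) ∈ W :=
      (hc z hz.1 i).eventually_mem (hW.mem_nhds (by simpa using hz.2))
    filter_upwards [h1, h2] with t ht1 ht2
    refine ⟨?_, ht2⟩
    intro j _
    rcases eq_or_ne j i with rfl | hj
    · simpa using ht1
    · simpa [hj] using hz.1 j (mem_univ j)
  have hbox : ∀ᶠ y in 𝓝 x, y ∈ univ.pi I :=
    (isOpen_set_pi finite_univ fun i _ => hI i).mem_nhds hx
  rw [ContinuousAt, tendsto_order]
  constructor
  -- Points near `x` lie below a corner `y` with `f y > a`, and `f` is antitone on the box. The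
  -- upper bound uses a corner below `x`.
  · intro a ha
    obtain ⟨y, hy, hyx⟩ := exists_mem_forall_rel_of_separately_open (sep (Ioi a) isOpen_Ioi)
      (r := fun a t => a < t) (fun a => (frequently_gt_nhds a)) (x := x) ⟨hx, ha⟩
    have h3 : ∀ᶠ z in 𝓝 x, ∀ i, z i < y i := by
      rw [eventually_all]
      exact fun i => (continuous_apply i).continuousAt.eventually_lt continuousAt_const (hyx i)
    filter_upwards [hbox, h3] with z hz h3
    exact lt_of_lt_of_le hy.2 (hanti hz hy.1 fun i => (h3 i).le)
  · intro a ha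
    obtain ⟨y, hy, hyx⟩ := exists_mem_forall_rel_of_separately_open (sep (Iio a) isOpen_Iio)
      (r := fun a t => t < a) (fun a => (frequently_lt_nhds a)) (x := x) ⟨hx, ha⟩
    have h3 : ∀ᶠ z in 𝓝 x, ∀ i, y i < z i := by
      rw [eventually_all]
      exact fun i => continuousAt_const.eventually_lt (continuous_apply i).continuousAt (hyx i)
    filter_upwards [hbox, h3] with z hz h3
    exact lt_of_le_of_lt (hanti hy.1 hz fun i => (h3 i).le) hy.2

lemma toLp_update_eq_add_smul {J : ℕ} (z : Fin J → ℝ) (j : Fin J) (t s : ℝ) :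
    (WithLp.toLp 2 (Function.update z j s) : Cov J) =
      WithLp.toLp 2 (Function.update z j t) + (s - t) • EuclideanSpace.single j (1 : ℝ) := by
  ext i
  rcases eq_or_ne i j with rfl | hij <;> simp [*]

lemma hasDerivAt_toLp_update {J : ℕ} {f : Cov J → ℝ} {z : Fin J → ℝ} {j : Fin J} {t : ℝ}
    (h : LineDifferentiableAt ℝ f (WithLp.toLp 2 (Function.update z j t))
      (EuclideanSpace.single j 1)) :
    HasDerivAt (fun s => f (WithLp.toLp 2 (Function.update z j s)))
      (partialD f j (WithLp.toLp 2 (Function.update z j t))) t := by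
  have h1 : HasDerivAt (fun s : ℝ => f (WithLp.toLp 2 (Function.update z j t) +
      s • EuclideanSpace.single j (1 : ℝ)))
      (partialD f j (WithLp.toLp 2 (Function.update z j t))) (t - t) := by
    rw [sub_self]; exact h.hasLineDerivAt
  have h2 := h1.comp_sub_const t t
  refine h2.congr_of_eventuallyEq (Filter.Eventually.of_forall fun s => ?_)
  simp only
  rw [← toLp_update_eq_add_smul]

open Filter Topology in
/-- A function whose partial derivatives exist and are bounded above is continuous. -/
lemma continuousAt_of_partialD_le {J : ℕ} {f : Cov J → ℝ} {D : Set (Cov J)} (hD : IsOpen D)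
    {B : Fin J → ℝ}
    (h : ∀ y ∈ D, ∀ j, LineDifferentiableAt ℝ f y (EuclideanSpace.single j 1) ∧
      partialD f j y ≤ B j) {x : Cov J} (hx : x ∈ D) : ContinuousAt f x := by
  have hcont : Continuous (fun z : Fin J → ℝ => (WithLp.toLp 2 z : Cov J)) :=
    PiLp.continuous_toLp 2 _
  have hD' : IsOpen ((fun z : Fin J → ℝ => (WithLp.toLp 2 z : Cov J)) ⁻¹' D) := hD.preimage hcont
  obtain ⟨r, hr, hball⟩ := Metric.isOpen_iff.1 hD' x.ofLp hx
  -- In the sup norm a ball is a box, hence the passage from `Cov J` to `Fin J → ℝ`.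
  set I : Fin J → Set ℝ := fun i => Metric.ball (x i) r with hI
  have hbox : univ.pi I = Metric.ball x.ofLp r := (ball_pi _ hr).symm
  -- Subtracting the linear function with slopes `B i` makes all partial derivatives nonpositive.
  set F : (Fin J → ℝ) → ℝ := fun z => f (WithLp.toLp 2 z) - ∑ i, B i * z i with hF
  have hmem : ∀ z ∈ univ.pi I, ∀ i, ∀ t ∈ I i, Function.update z i t ∈ univ.pi I := by
    intro z hz i t ht j _
    rcases eq_or_ne j i with rfl | hj
    · simpa using ht
    · simpa [hj] using hz j (mem_univ j)
  have hder : ∀ z ∈ univ.pi I, ∀ i, ∀ t ∈ I i, HasDerivAt (fun s => F (Function.update z i s))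
      (partialD f i (WithLp.toLp 2 (Function.update z i t)) - B i) t := by
    intro z hz i t ht
    have hin : (WithLp.toLp 2 (Function.update z i t) : Cov J) ∈ D :=
      hball (hbox ▸ hmem z hz i t ht)
    refine (hasDerivAt_toLp_update (h _ hin i).1).sub ?_
    have : ∀ s, ∑ j, B j * Function.update z i s j
        = B i * s + ∑ j ∈ Finset.univ.erase i, B j * z j := by
      intro s
      rw [← Finset.add_sum_erase _ _ (Finset.mem_univ i)]
      congr 1
      · simp
      · refine Finset.sum_congr rfl fun j hj => ?_
        rw [Function.update_of_ne (Finset.ne_of_mem_erase hj)]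
    simp_rw [this]
    simpa using ((hasDerivAt_id t).const_mul (B i)).add_const
      (∑ j ∈ Finset.univ.erase i, B j * z j)
  have hFc : ContinuousAt F x.ofLp := by
    refine continuousAt_of_separately_antitone (I := I) (fun i => Metric.isOpen_ball) ?_ ?_
      (hbox ▸ Metric.mem_ball_self hr)
    · intro z hz i
      refine antitoneOn_of_deriv_nonpos (convex_ball _ _) ?_ ?_ ?_
      · exact fun t ht => (hder z hz i t ht).continuousAt.continuousWithinAt
      · intro t ht
        rw [Metric.isOpen_ball.interior_eq] at ht
        exact (hder z hz i t ht).differentiableAt.differentiableWithinAt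
      · intro t ht
        rw [Metric.isOpen_ball.interior_eq] at ht
        rw [(hder z hz i t ht).deriv]
        have hin : (WithLp.toLp 2 (Function.update z i t) : Cov J) ∈ D :=
          hball (hbox ▸ hmem z hz i t ht)
        linarith [(h _ hin i).2]
    · exact fun z hz i => (hder z hz i (z i) (hz i (mem_univ i))).continuousAt
  have h2 : ContinuousAt (fun z : Fin J → ℝ => f (WithLp.toLp 2 z)) x.ofLp := by
    have : ContinuousAt (fun z : Fin J → ℝ => F z + ∑ i, B i * z i) x.ofLp :=
      hFc.add (Continuous.continuousAt (by fun_prop))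
    simpa [hF] using this
  have h3 : ContinuousAt (fun y : Cov J => y.ofLp) x := (PiLp.continuous_ofLp 2 _).continuousAt
  exact ContinuousAt.comp (g := fun z : Fin J → ℝ => f (WithLp.toLp 2 z)) h2 h3

/-! ### Euler's theorem and integration of the logarithmic gradient. -/

lemma partialD_eq_fderiv {J : ℕ} {f : Cov J → ℝ} {x : Cov J} (h : DifferentiableAt ℝ f x)
    (j : Fin J) : partialD f j x = fderiv ℝ f x (EuclideanSpace.single j 1) :=
  h.lineDeriv_eq_fderiv

lemma fderiv_apply_eq_sum_partialD {J : ℕ} {f : Cov J → ℝ} {x : Cov J}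
    (h : DifferentiableAt ℝ f x) (v : Cov J) :
    fderiv ℝ f x v = ∑ j, partialD f j x * v j := by
  have hv : v = ∑ j, v j • EuclideanSpace.single j (1 : ℝ) := by
    ext i
    simp [Finset.sum_apply, Pi.single_apply]
  conv_lhs => rw [hv]
  simp only [map_sum, map_smul, smul_eq_mul]
  exact Finset.sum_congr rfl fun j _ => by rw [partialD_eq_fderiv h, mul_comm]

/-- Euler's theorem on homogeneous functions of degree one. -/
lemma fderiv_self_of_homogeneous {J : ℕ} {g : Cov J → ℝ} {D : Set (Cov J)} (hD : IsOpen D)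
    (hom : ∀ x ∈ D, ∀ t : ℝ, 0 < t → t • x ∈ D → g (t • x) = t * g x) {x : Cov J} (hx : x ∈ D)
    (hd : DifferentiableAt ℝ g x) : fderiv ℝ g x x = g x := by
  have h1 : HasDerivAt (fun t : ℝ => g (t • x)) (fderiv ℝ g x x) 1 := by
    have hl : HasDerivAt (fun t : ℝ => t • x) x 1 := by
      simpa using (hasDerivAt_id (1 : ℝ)).smul_const x
    have hg : HasFDerivAt g (fderiv ℝ g x) ((1 : ℝ) • x) := by
      rw [one_smul]; exact hd.hasFDerivAt
    exact hg.comp_hasDerivAt (1 : ℝ) hl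
  have h2 : HasDerivAt (fun t : ℝ => t * g x) (g x) 1 := by
    simpa using (hasDerivAt_id (1 : ℝ)).mul_const (g x)
  refine h1.unique (h2.congr_of_eventuallyEq ?_)
  have hc : ContinuousAt (fun t : ℝ => t • x) 1 := by fun_prop
  filter_upwards [hc.eventually_mem (hD.mem_nhds (by simpa using hx)),
    lt_mem_nhds (zero_lt_one' ℝ)] with t ht ht0
  exact hom x hx t ht0 ht

lemma continuousOn_partialD {J : ℕ} {g : Cov J → ℝ} {D : Set (Cov J)} (hD : IsOpen D)
    (hg : ContDiffOn ℝ 1 g D) (j : Fin J) : ContinuousOn (partialD g j) D := by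
  have h : ContinuousOn (fun x => fderiv ℝ g x (EuclideanSpace.single j 1)) D :=
    (hg.continuousOn_fderiv_of_isOpen hD le_rfl).clm_apply continuousOn_const
  exact h.congr fun x hx =>
    partialD_eq_fderiv ((hg.differentiableOn one_ne_zero).differentiableAt (hD.mem_nhds hx)) j

/-- Recovering a nonvanishing function from its logarithmic gradient along a path. -/
lemma eq_mul_exp_integral_logDeriv {J : ℕ} {g : Cov J → ℝ} {D : Set (Cov J)} (hD : IsOpen D)
    (hg : ContDiffOn ℝ 1 g D) {γ γ' : ℝ → Cov J} {a b : ℝ}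
    (hmem : ∀ t ∈ uIcc a b, γ t ∈ D ∩ {y | g y ≠ 0}) (hc : ContinuousOn γ (uIcc a b))
    {s : Set ℝ} (hs : s.Countable)
    (hd : ∀ t ∈ Ioo (min a b) (max a b) \ s, HasDerivAt γ (γ' t) t)
    (hi : IntervalIntegrable γ' volume a b) :
    IntervalIntegrable (fun t => ∑ j, partialD g j (γ t) / g (γ t) * γ' t j) volume a b ∧
      g (γ b) = g (γ a) * Real.exp (∫ t in a..b, ∑ j, partialD g j (γ t) / g (γ t) * γ' t j) := by
  have hgd : ∀ x ∈ D, DifferentiableAt ℝ g x := fun x hx =>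
    (hg.differentiableOn one_ne_zero).differentiableAt (hD.mem_nhds hx)
  have hgγ : ContinuousOn (fun t => g (γ t)) (uIcc a b) :=
    hg.continuousOn.comp hc fun t ht => (hmem t ht).1
  have hint : IntervalIntegrable (fun t => ∑ j, partialD g j (γ t) / g (γ t) * γ' t j)
      volume a b := by
    have hj : ∀ j, IntervalIntegrable (fun t => partialD g j (γ t) / g (γ t) * γ' t j)
        volume a b := by
      intro j
      have h1 : IntervalIntegrable (fun t => γ' t j) volume a b := by
        constructor
        · exact (EuclideanSpace.proj (𝕜 := ℝ) j).integrable_comp hi.1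
        · exact (EuclideanSpace.proj (𝕜 := ℝ) j).integrable_comp hi.2
      refine h1.continuousOn_mul ?_
      exact ((continuousOn_partialD hD hg j).comp hc fun t ht => (hmem t ht).1).div hgγ
        fun t ht => (hmem t ht).2
    have := IntervalIntegrable.sum Finset.univ (fun j _ => hj j)
    convert! this using 1
    ext t
    simp
  refine ⟨hint, ?_⟩
  -- `Real.log` is `log |·|`, so the sign of `g` is immaterial here.
  have hftc := integral_eq_of_hasDerivAt_off_countable (fun t => Real.log (g (γ t)))
    (fun t => ∑ j, partialD g j (γ t) / g (γ t) * γ' t j) hs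
    (hgγ.log fun t ht => (hmem t ht).2) (fun t ht => by
      have htI : t ∈ uIcc a b := Ioo_subset_Icc_self ht.1
      have h1 := ((hgd _ (hmem t htI).1).hasFDerivAt.comp_hasDerivAt t (hd t ht)).log
        (hmem t htI).2
      rw [fderiv_apply_eq_sum_partialD (hgd _ (hmem t htI).1), Finset.sum_div] at h1
      exact h1.congr_deriv (Finset.sum_congr rfl fun j _ => by
        rw [Function.comp_apply]; ring)) hint
  rw [hftc, Real.exp_sub, Real.exp_log_eq_abs (hmem b right_mem_uIcc).2,
    Real.exp_log_eq_abs (hmem a left_mem_uIcc).2]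
  have ha := (hmem a left_mem_uIcc).2
  have hb := (hmem b right_mem_uIcc).2
  -- By the intermediate value theorem `g` cannot change sign along the path, so the absolute values
  -- can be removed.
  have hsign : 0 < g (γ a) * g (γ b) := by
    by_contra hneg
    have h0 : (0 : ℝ) ∈ uIcc (g (γ a)) (g (γ b)) := by
      rw [mem_uIcc]
      rcases mul_nonpos_iff.1 (not_lt.1 hneg) with h | h
      · exact Or.inr ⟨h.2, h.1⟩
      · exact Or.inl h
    obtain ⟨t, ht, ht0⟩ := intermediate_value_uIcc hgγ h0
    exact (hmem t ht).2 ht0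
  rcases mul_pos_iff.1 hsign with h | h
  · rw [abs_of_pos h.1, abs_of_pos h.2, mul_div_cancel₀ _ h.1.ne']
  · rw [abs_of_neg h.1, abs_of_neg h.2, neg_div_neg_eq, mul_div_cancel₀ _ h.1.ne]

lemma hasDerivAt_stair {J : ℕ} (a x : Cov J) (j : Fin J) (t : ℝ) :
    HasDerivAt (stair a x j) (EuclideanSpace.single j 1) t := by
  have h : stair a x j = fun t : ℝ => stair a x j 0 + t • EuclideanSpace.single j (1 : ℝ) := by
    ext t i
    rcases lt_trichotomy i j with hij | rfl | hij
    · simp [stair, hij, hij.ne]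
    · simp [stair]
    · simp [stair, hij.not_gt, hij.ne']
  rw [h]
  simpa using ((hasDerivAt_id t).smul_const (EuclideanSpace.single j (1 : ℝ))).const_add
    (stair a x j 0)

/-- The staircase version of `eq_mul_exp_integral_logDeriv`. -/
lemma eq_mul_exp_sum_integral_stair {J : ℕ} {g : Cov J → ℝ} {D : Set (Cov J)} (hD : IsOpen D)
    (hg : ContDiffOn ℝ 1 g D) {a x : Cov J}
    (hmem : ∀ j : Fin J, ∀ t ∈ uIcc (a j) (x j), stair a x j t ∈ D ∩ {y | g y ≠ 0}) :
    (∀ j : Fin J, IntervalIntegrable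
      (fun t => partialD g j (stair a x j t) / g (stair a x j t)) volume (a j) (x j)) ∧
    g x = g a * Real.exp (∑ j, ∫ t in (a j)..(x j),
      partialD g j (stair a x j t) / g (stair a x j t)) := by
  have key : ∀ j : Fin J, IntervalIntegrable
      (fun t => partialD g j (stair a x j t) / g (stair a x j t)) volume (a j) (x j) ∧
      g (stair a x j (x j)) = g (stair a x j (a j)) * Real.exp (∫ t in (a j)..(x j),
        partialD g j (stair a x j t) / g (stair a x j t)) := by
    intro j
    have h := eq_mul_exp_integral_logDeriv hD hg (γ := stair a x j)
      (γ' := fun _ => EuclideanSpace.single j 1) (hmem j)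
      (fun t _ => (hasDerivAt_stair a x j t).continuousAt.continuousWithinAt)
      (s := ∅) countable_empty (fun t _ => hasDerivAt_stair a x j t) intervalIntegrable_const
    simpa [Pi.single_apply] using h
  refine ⟨fun j => (key j).1, ?_⟩
  set I : Fin J → ℝ := fun j => ∫ t in (a j)..(x j),
    partialD g j (stair a x j t) / g (stair a x j t) with hI
  -- `p n` takes its first `n` coordinates from `x`; the `j`-th leg joins `p j` to `p (j + 1)`, and
  -- the exponentials telescope.
  set p : ℕ → Cov J := fun n => WithLp.toLp 2 (fun i : Fin J => if (i : ℕ) < n then x i else a i)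
    with hp
  have h1 : ∀ j : Fin J, stair a x j (a j) = p j := by
    intro j
    ext i
    rcases lt_trichotomy i j with hij | rfl | hij
    · simp [stair, hp, hij]
    · simp [stair, hp]
    · simp [stair, hp, hij.not_gt, hij.ne']
  have h2 : ∀ j : Fin J, stair a x j (x j) = p (j + 1) := by
    intro j
    ext i
    rcases lt_trichotomy i j with hij | rfl | hij
    · simp [stair, hp, hij, hij.le]
    · simp [stair, hp]
    · simp [stair, hp, hij.not_gt, hij.ne', hij.not_ge]
  have hn : ∀ n ≤ J, g (p n) = g (p 0) *
      Real.exp (∑ j ∈ Finset.univ.filter (fun j : Fin J => (j : ℕ) < n), I j) := by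
    intro n
    induction n with
    | zero => simp
    | succ n ih =>
      intro hnJ
      have h3 := (key ⟨n, hnJ⟩).2
      rw [h1, h2] at h3
      have hfil : Finset.univ.filter (fun j : Fin J => (j : ℕ) < n + 1) =
          insert ⟨n, hnJ⟩ (Finset.univ.filter (fun j : Fin J => (j : ℕ) < n)) := by
        ext j
        simp [Fin.ext_iff]
        omega
      rw [hfil, Finset.sum_insert (by simp), add_comm (I _), Real.exp_add, ← mul_assoc,
        ← ih (by omega)]
      exact h3
  have h0 : p 0 = a := by ext i; simp [hp]
  have hJ : p J = x := by ext i; simp [hp]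
  have := hn J le_rfl
  rw [h0, hJ] at this
  rw [this]
  congr 3
  exact Finset.filter_true_of_mem fun j _ => j.2

/-! ### Constancy of the factor between proportional gradients. -/

lemma eq_endpoints_of_hasDerivAt_zero_off_countable {f : ℝ → ℝ} {a b : ℝ} {s : Set ℝ}
    (hs : s.Countable) (hc : ContinuousOn f (uIcc a b))
    (hd : ∀ t ∈ Ioo (min a b) (max a b) \ s, HasDerivAt f 0 t) : f b = f a := by
  have h := integral_eq_of_hasDerivAt_off_countable f (fun _ => (0 : ℝ)) hs hc hd
    intervalIntegrable_const
  simp only [intervalIntegral.integral_zero] at h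
  linarith

open Filter Topology in
/-- Two functions with proportional gradients, the factor of proportionality being also the ratio
of the functions, differ by a constant factor. -/
lemma exists_const_of_fderiv_eq_smul {J : ℕ} {g h L : Cov J → ℝ} {D : Set (Cov J)}
    (hD : IsOpen D) (hDc : IsConnected D) (hg : ContDiffOn ℝ 1 g D) (hh : ContDiffOn ℝ 1 h D)
    (k : Fin J) (hk : ∀ x ∈ D, partialD g k x ≠ 0)
    (hL : ∀ x ∈ D, fderiv ℝ h x = L x • fderiv ℝ g x) (hval : ∀ x ∈ D, h x = L x * g x) :
    ∀ x ∈ D, ∀ y ∈ D, L x = L y := by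
  have hgd : ∀ x ∈ D, DifferentiableAt ℝ g x := fun x hx =>
    (hg.differentiableOn one_ne_zero).differentiableAt (hD.mem_nhds hx)
  have hhd : ∀ x ∈ D, DifferentiableAt ℝ h x := fun x hx =>
    (hh.differentiableOn one_ne_zero).differentiableAt (hD.mem_nhds hx)
  have hLc : ContinuousOn L D := by
    have : ContinuousOn (fun x => partialD h k x / partialD g k x) D :=
      (continuousOn_partialD hD hh k).div (continuousOn_partialD hD hg k) hk
    refine this.congr fun x hx => ?_
    rw [eq_div_iff (hk x hx), partialD_eq_fderiv (hhd x hx), partialD_eq_fderiv (hgd x hx),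
      hL x hx]
    simp
  -- Here `L = h / g`, and the numerator in the quotient rule is `L g ∇g - L g ∇g`.
  have hLd : ∀ x ∈ D, g x ≠ 0 → HasFDerivAt L (0 : Cov J →L[ℝ] ℝ) x := by
    intro x hx hgx
    have h1 := (hhd x hx).hasFDerivAt.mul
      ((hasDerivAt_inv hgx).comp_hasFDerivAt x (hgd x hx).hasFDerivAt)
    have h2 : HasFDerivAt (fun y => h y / g y) (0 : Cov J →L[ℝ] ℝ) x := by
      refine (h1.congr_fderiv ?_).congr_of_eventuallyEq
        (Filter.Eventually.of_forall fun y => by simp [div_eq_mul_inv])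
      rw [hL x hx, hval x hx]
      ext v
      simp
      field_simp
      ring
    refine h2.congr_of_eventuallyEq ?_
    filter_upwards [hD.mem_nhds hx, (hgd x hx).continuousAt.eventually_ne hgx] with y hy hgy
    rw [hval y hy, mul_div_cancel_right₀ _ hgy]
  set e : Cov J := EuclideanSpace.single k (1 : ℝ) with he
  have hline : ∀ (x : Cov J) (t : ℝ), HasDerivAt (fun s : ℝ => x + s • e) e t := by
    intro x t
    simpa using ((hasDerivAt_id t).smul_const e).const_add x
  -- By Rolle `g` is injective along direction `e`, so it vanishes at most once on the segment;
  -- continuity carries `L` across that point.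
  have hvert : ∀ x : Cov J, ∀ s : ℝ, 0 < s → (∀ t ∈ Icc 0 s, x + t • e ∈ D) →
      InjOn (fun t : ℝ => g (x + t • e)) (Icc 0 s) ∧ L (x + s • e) = L x := by
    intro x s hs hseg
    have hgder : ∀ t ∈ Icc 0 s, HasDerivAt (fun t : ℝ => g (x + t • e))
        (partialD g k (x + t • e)) t := by
      intro t ht
      rw [partialD_eq_fderiv (hgd _ (hseg t ht))]
      exact (hgd _ (hseg t ht)).hasFDerivAt.comp_hasDerivAt t (hline x t)
    have hinj : InjOn (fun t : ℝ => g (x + t • e)) (Icc 0 s) := by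
      have hlt : ∀ t₁ ∈ Icc 0 s, ∀ t₂ ∈ Icc 0 s, t₁ < t₂ →
          g (x + t₁ • e) ≠ g (x + t₂ • e) := by
        intro t₁ h₁ t₂ h₂ hlt heq
        have hsub : Icc t₁ t₂ ⊆ Icc 0 s := Icc_subset_Icc h₁.1 h₂.2
        obtain ⟨c, hc, hc0⟩ := exists_hasDerivAt_eq_zero hlt
          (fun t ht => (hgder t (hsub ht)).continuousAt.continuousWithinAt) heq
          (fun t ht => hgder t (hsub (Ioo_subset_Icc_self ht)))
        exact hk _ (hseg c (hsub (Ioo_subset_Icc_self hc))) hc0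
      intro t₁ h₁ t₂ h₂ heq
      rcases lt_trichotomy t₁ t₂ with h | h | h
      · exact absurd heq (hlt _ h₁ _ h₂ h)
      · exact h
      · exact absurd heq.symm (hlt _ h₂ _ h₁ h)
    refine ⟨hinj, ?_⟩
    have := eq_endpoints_of_hasDerivAt_zero_off_countable (f := fun t : ℝ => L (x + t • e))
      (a := 0) (b := s) (s := {t | t ∈ Icc 0 s ∧ g (x + t • e) = 0}) ?_ ?_ ?_
    · simpa using this
    · refine Set.Subsingleton.countable fun t₁ h₁ t₂ h₂ => hinj h₁.1 h₂.1 ?_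
      exact h₁.2.trans h₂.2.symm
    · rw [uIcc_of_le hs.le]
      exact hLc.comp (fun t _ => (hline x t).continuousAt.continuousWithinAt) hseg
    · rw [min_eq_left hs.le, max_eq_right hs.le]
      rintro t ⟨ht, hts⟩
      have htI : t ∈ Icc 0 s := Ioo_subset_Icc_self ht
      have hne : g (x + t • e) ≠ 0 := fun h => hts ⟨htI, h⟩
      exact ((hLd _ (hseg t htI) hne).comp_hasDerivAt t (hline x t)).congr_deriv (by simp)
  have hball : ∀ (x : Cov J) (r : ℝ), Metric.ball x r ⊆ D ∩ {y | g y ≠ 0} →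
      ∀ y ∈ Metric.ball x r, L y = L x := by
    intro x r hr y hy
    refine (convex_ball x r).is_const_of_fderivWithin_eq_zero (𝕜 := ℝ) (f := L) ?_ ?_ hy
      (Metric.mem_ball_self (Metric.pos_of_mem_ball hy))
    · exact fun z hz => (hLd z (hr hz).1 (hr hz).2).differentiableAt.differentiableWithinAt
    · intro z hz
      exact (hLd z (hr hz).1 (hr hz).2).hasFDerivWithinAt.fderivWithin
        (Metric.isOpen_ball.uniqueDiffWithinAt hz)
  have hopen : IsOpen (D ∩ {y | g y ≠ 0}) :=
    hg.continuousOn.isOpen_inter_preimage hD isOpen_ne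
  -- At a zero `x` of `g`, the point `x + s • e` is not a zero, so `L` is constant near it. For `y`
  -- near `x` this gives `L y = L (y + s • e) = L (x + s • e) = L x`.
  have hloc : ∀ x ∈ D, ∀ᶠ y in 𝓝 x, L y = L x := by
    intro x hx
    by_cases hgx : g x = 0
    · obtain ⟨r, hr, hrD⟩ := Metric.isOpen_iff.1 hD x hx
      have hnorm : ‖e‖ = 1 := by simp [he]
      set s : ℝ := r / 2 with hsdef
      have hs : 0 < s := by positivity
      have hseg : ∀ y ∈ Metric.ball x s, ∀ t ∈ Icc 0 s, y + t • e ∈ D := by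
        intro y hy t ht
        apply hrD
        rw [Metric.mem_ball, dist_eq_norm] at *
        calc ‖y + t • e - x‖ = ‖(y - x) + t • e‖ := by congr 1; abel
          _ ≤ ‖y - x‖ + ‖t • e‖ := norm_add_le _ _
          _ < s + s := by
            rw [norm_smul, hnorm, mul_one, Real.norm_of_nonneg ht.1]
            linarith [ht.2]
          _ = r := by rw [hsdef]; ring
      obtain ⟨hinj, hLx⟩ := hvert x s hs (hseg x (Metric.mem_ball_self hs))
      have hne : g (x + s • e) ≠ 0 := by
        intro h0
        have := hinj (right_mem_Icc.2 hs.le) (left_mem_Icc.2 hs.le) (by simp [h0, hgx])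
        exact hs.ne' this
      obtain ⟨δ, hδ, hδD⟩ := Metric.isOpen_iff.1 hopen (x + s • e)
        ⟨hseg x (Metric.mem_ball_self hs) s (right_mem_Icc.2 hs.le), hne⟩
      filter_upwards [Metric.ball_mem_nhds x hδ, Metric.ball_mem_nhds x hs] with y hyδ hys
      rw [← (hvert y s hs (hseg y hys)).2, ← hLx]
      exact hball _ δ hδD _ (by simpa [Metric.mem_ball] using hyδ)
    · obtain ⟨δ, hδ, hδD⟩ := Metric.isOpen_iff.1 hopen x ⟨hx, hgx⟩
      filter_upwards [Metric.ball_mem_nhds x hδ] with y hy using hball x δ hδD y hy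
  intro x hx y hy
  have hF : ∀ z ∈ D, HasFDerivAt L (0 : Cov J →L[ℝ] ℝ) z := fun z hz =>
    (hasFDerivAt_const (L z) z).congr_of_eventuallyEq (hloc z hz)
  exact hD.is_const_of_fderiv_eq_zero hDc.isPreconnected
    (fun z hz => (hF z hz).differentiableAt.differentiableWithinAt)
    (fun z hz => (hF z hz).fderiv) hx hy

/-! ### Conditional laws of the latent outcome as translates. -/

/-- The shear acts fibrewise, so its image is again a disintegration; writing it with a kernel makes
uniqueness of disintegrations applicable. -/
lemma map_compProd_add {α : Type*} [MeasurableSpace α] {ν : Measure α} [IsProbabilityMeasure ν]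
    {κ : Kernel α ℝ} [IsMarkovKernel κ] {f : α → ℝ} (hf : Measurable f) :
    (ν ⊗ₘ κ).map (fun p => (p.1, f p.1 + p.2)) =
      ν ⊗ₘ ((Kernel.id ×ₖ κ).map (fun p : α × ℝ => f p.1 + p.2)) := by
  have hm : Measurable (fun p : α × ℝ => f p.1 + p.2) := by fun_prop
  have hm2 : Measurable (fun p : α × ℝ => (p.1, f p.1 + p.2)) := by fun_prop
  ext s hs
  rw [Measure.map_apply hm2 hs, Measure.compProd_apply (hm2 hs), Measure.compProd_apply hs]
  refine lintegral_congr fun a => ?_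
  have hs' : MeasurableSet ((fun p : α × ℝ => f p.1 + p.2) ⁻¹' (Prod.mk a ⁻¹' s)) :=
    hm (measurable_prodMk_left hs)
  rw [Kernel.map_apply' _ hm _ (measurable_prodMk_left hs), Kernel.prod_apply, Kernel.id_apply,
    Measure.prod_apply hs', lintegral_dirac' _ (measurable_measure_prodMk_left hs')]
  rfl

lemma id_prod_map_add_apply {α : Type*} [MeasurableSpace α]
    {κ : Kernel α ℝ} [IsMarkovKernel κ] {f : α → ℝ} (hf : Measurable f) (a : α) :
    ((Kernel.id ×ₖ κ).map (fun p : α × ℝ => f p.1 + p.2)) a = (κ a).map (fun u => f a + u) := by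
  have hm : Measurable (fun p : α × ℝ => f p.1 + p.2) := by fun_prop
  have hm' : Measurable (fun u : ℝ => f a + u) := by fun_prop
  ext s hs
  rw [Kernel.map_apply' _ hm _ hs, Kernel.prod_apply, Kernel.id_apply,
    Measure.prod_apply (hm hs), lintegral_dirac' _ (measurable_measure_prodMk_left (hm hs)),
    Measure.map_apply hm' hs]
  rfl

namespace Model

variable {J Rbar : ℕ} {D : Set (Cov J)} {Ω : Type*} [MeasurableSpace Ω]
  {𝒱 : Type*} [MeasurableSpace 𝒱]

/-- Under exogeneity, `H` is conditionally distributed as a shift by `g(x)` of a distribution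
depending on `v` only. -/
lemma ae_kerH_eq_map [StandardBorelSpace Ω] (M : Model J Rbar D Ω 𝒱) (hD : IsOpen D)
    (hg : ContinuousOn M.g D) (hM : M.Exog) :
    ∃ κ : Kernel 𝒱 ℝ, IsMarkovKernel κ ∧ ∀ᵐ v ∂(M.μ.map M.V), ∀ᵐ x ∂(M.μ.map M.X),
      x ∈ D ∧ M.kerH (x, v) = (κ v).map (fun u => M.g x + u) := by
  have := M.isMarkov
  have hX := M.measurable_X
  have hV := M.measurable_V
  have hU := M.measurable_U
  have : IsProbabilityMeasure (M.μ.map M.X) := Measure.isProbabilityMeasure_map hX.aemeasurable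
  have : IsProbabilityMeasure (M.μ.map M.V) := Measure.isProbabilityMeasure_map hV.aemeasurable
  have hXV : Measurable (fun ω => (M.X ω, M.V ω)) := hX.prodMk hV
  have : IsProbabilityMeasure (M.μ.map (fun ω => (M.X ω, M.V ω))) :=
    Measure.isProbabilityMeasure_map hXV.aemeasurable
  set κ := condDistrib M.U M.V M.μ with hκ
  refine ⟨κ, inferInstance, ?_⟩
  -- `g` is controlled only on `D`; cutting it off outside gives a measurable function and changes
  -- nothing, as `X` stays in `D`.
  set g₀ : Cov J → ℝ := D.indicator M.g with hg₀
  have hg₀m : Measurable g₀ := by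
    classical
    rw [hg₀, ← piecewise_eq_indicator]
    exact hg.measurable_piecewise continuousOn_const hD.measurableSet
  set f : Cov J × 𝒱 → ℝ := fun p => g₀ p.1 with hf
  have hfm : Measurable f := hg₀m.comp measurable_fst
  have hlawU : M.μ.map (fun ω => ((M.X ω, M.V ω), M.U ω)) =
      M.μ.map (fun ω => (M.X ω, M.V ω)) ⊗ₘ (Kernel.prodMkLeft (Cov J) κ) := by
    have h1 := (condIndepFun_iff_condDistrib_prod_ae_eq_prodMkRight hU hX hV).1 hM.2
    rw [condDistrib_ae_eq_iff_measure_eq_compProd _ hU.aemeasurable] at h1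
    have h2 : HasCondDistrib M.U (fun ω => (M.V ω, M.X ω)) (Kernel.prodMkRight (Cov J) κ) M.μ :=
      ⟨by fun_prop, h1⟩
    exact (h2.measurableEquiv_comp_right MeasurableEquiv.prodComm).map_eq
  have hlawH := M.hasCondDistrib.map_eq
  have hH : ∀ ω, M.g (M.X ω) + M.U ω = f (M.X ω, M.V ω) + M.U ω := by
    intro ω
    simp [hf, hg₀, indicator_of_mem (M.X_mem ω)]
  simp_rw [hH] at hlawH
  have hlawH' : M.μ.map (fun ω => ((M.X ω, M.V ω), f (M.X ω, M.V ω) + M.U ω)) =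
      (M.μ.map (fun ω => ((M.X ω, M.V ω), M.U ω))).map (fun p => (p.1, f p.1 + p.2)) := by
    rw [Measure.map_map (by fun_prop) (by fun_prop)]
    rfl
  rw [hlawH', hlawU, map_compProd_add hfm] at hlawH
  have : IsMarkovKernel ((Kernel.id ×ₖ Kernel.prodMkLeft (Cov J) κ).map
      (fun p : (Cov J × 𝒱) × ℝ => f p.1 + p.2)) := Kernel.IsMarkovKernel.map _ (by fun_prop)
  have hae := Kernel.ae_eq_of_compProd_eq hlawH.symm
  -- Independence of `X` and `V` makes the joint law a product, so after a swap the exceptional set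
  -- can be sliced with `v` outermost.
  rw [(indepFun_iff_map_prod_eq_prod_map_map hX.aemeasurable hV.aemeasurable).1 hM.1] at hae
  have hswap := Measure.measurePreserving_swap.quasiMeasurePreserving.ae hae
  have hXD : ∀ᵐ x ∂(M.μ.map M.X), x ∈ D :=
    (ae_map_iff hX.aemeasurable hD.measurableSet).2 (Filter.Eventually.of_forall M.X_mem)
  filter_upwards [Measure.ae_ae_of_ae_prod hswap] with v hv
  filter_upwards [hv, hXD] with x hx hxD
  refine ⟨hxD, ?_⟩
  have h3 : M.kerH (x, v) = _ := hx
  rw [h3, id_prod_map_add_apply hfm]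
  simp [hf, hg₀, hxD]

end Model

/-! ### Quantiles, and the translation property at every covariate value. -/

open Filter Topology in
/-- The Galois connection between the quantile function and the distribution function. -/
lemma quantile_le_iff {ν : Measure ℝ} {α : ℝ} (hα : α ∈ Ioo (0 : ℝ) 1) (h : ℝ) :
    sInf {h : ℝ | α ≤ cdf ν h} ≤ h ↔ α ≤ cdf ν h := by
  have hbdd : BddBelow {h : ℝ | α ≤ cdf ν h} := by
    obtain ⟨b, hb⟩ := ((tendsto_cdf_atBot ν).eventually_lt_const hα.1).exists
    refine ⟨b, fun s hs => ?_⟩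
    by_contra hlt
    exact absurd (hs.trans (monotone_cdf ν (not_le.1 hlt).le)) (not_le.2 hb)
  have hne : {h : ℝ | α ≤ cdf ν h}.Nonempty := by
    obtain ⟨b, hb⟩ := ((tendsto_cdf_atTop ν).eventually_const_lt hα.2).exists
    exact ⟨b, hb.le⟩
  refine ⟨fun hle => ?_, fun hle => csInf_le hbdd hle⟩
  have hev : ∀ᶠ t in 𝓝[>] h, α ≤ cdf ν t := by
    filter_upwards [self_mem_nhdsWithin] with t ht
    obtain ⟨s, hs, hst⟩ := exists_lt_of_csInf_lt hne (lt_of_le_of_lt hle ht)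
    exact le_trans hs (monotone_cdf ν hst.le)
  have hrc : Tendsto (cdf ν) (𝓝[>] h) (𝓝 (cdf ν h)) :=
    ((cdf ν).right_continuous h).mono_left (nhdsWithin_mono _ Ioi_subset_Ici_self)
  exact ge_of_tendsto hrc hev

lemma quantile_shift {ν ν' : Measure ℝ} {c : ℝ} (hF : ∀ h, cdf ν' h = cdf ν (h - c)) {α : ℝ}
    (hα : α ∈ Ioo (0 : ℝ) 1) :
    sInf {h : ℝ | α ≤ cdf ν' h} = sInf {h : ℝ | α ≤ cdf ν h} + c := by
  refine eq_of_forall_ge_iff fun h => ?_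
  rw [quantile_le_iff hα, hF, ← quantile_le_iff hα, le_sub_iff_add_le]

/-- If the two values differed, a level `α` in `(0,1)` between them would contradict the Galois
connection. -/
lemma cdf_eq_of_quantile_shift {ν ν' : Measure ℝ} {c : ℝ}
    (hQ : ∀ α ∈ Ioo (0 : ℝ) 1,
      sInf {h : ℝ | α ≤ cdf ν' h} = sInf {h : ℝ | α ≤ cdf ν h} + c) (h : ℝ) :
    cdf ν' h = cdf ν (h - c) := by
  have hiff : ∀ α ∈ Ioo (0 : ℝ) 1, α ≤ cdf ν' h ↔ α ≤ cdf ν (h - c) := fun α hα => by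
    rw [← quantile_le_iff hα, hQ α hα, ← quantile_le_iff hα, le_sub_iff_add_le]
  refine le_antisymm (not_lt.1 fun hlt => ?_) (not_lt.1 fun hlt => ?_)
  · obtain ⟨α, h1, h2⟩ := exists_between hlt
    exact absurd ((hiff α ⟨(cdf_nonneg ν _).trans_lt h1, h2.trans_le (cdf_le_one ν' _)⟩).1 h2.le)
      (not_le.2 h1)
  · obtain ⟨α, h1, h2⟩ := exists_between hlt
    exact absurd ((hiff α ⟨(cdf_nonneg ν' _).trans_lt h1, h2.trans_le (cdf_le_one ν _)⟩).2 h2.le)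
      (not_le.2 h1)

lemma cdf_map_add {ν : Measure ℝ} [IsProbabilityMeasure ν] (c h : ℝ) :
    cdf (ν.map (fun u => c + u)) h = cdf ν (h - c) := by
  have hm : Measurable (fun u : ℝ => c + u) := by fun_prop
  have : IsProbabilityMeasure (ν.map (fun u => c + u)) :=
    Measure.isProbabilityMeasure_map hm.aemeasurable
  rw [cdf_eq_real, cdf_eq_real, map_measureReal_apply hm measurableSet_Iic]
  congr 1
  ext u
  simp [le_sub_iff_add_le']

namespace Model

variable {J Rbar : ℕ} {D : Set (Cov J)} {Ω : Type*} [MeasurableSpace Ω]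
  {𝒱 : Type*} [MeasurableSpace 𝒱]

lemma continuousAt_condQuantile (M : Model J Rbar D Ω 𝒱) (hD : IsOpen D) (hM : ∀ j, M.Reg j)
    {α : ℝ} (hα : α ∈ Ioo (0 : ℝ) 1) (v : 𝒱) {x : Cov J} (hx : x ∈ D) :
    ContinuousAt (fun y => M.condQuantile α y v) x := by
  choose B hB using fun j => (hM j).quantile_deriv
  exact continuousAt_of_partialD_le hD (B := B) (fun y hy j => hB j α hα y hy v) hx

/-- For almost all `v`, the conditional distributions of `H` at different covariate values are
shifts of each other. -/
lemma ae_kerH_shift [StandardBorelSpace Ω] (M : Model J Rbar D Ω 𝒱) (hD : IsOpen D)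
    (hM : M.Assumptions) :
    ∀ᵐ v ∂(M.μ.map M.V), ∀ x ∈ D, ∀ x' ∈ D,
      M.kerH (x', v) = (M.kerH (x, v)).map (fun u => (M.g x' - M.g x) + u) := by
  have := M.isMarkov
  have hgc : ContinuousOn M.g D := hM.structural.contDiff.continuousOn
  obtain ⟨κ, hκ, hae⟩ := M.ae_kerH_eq_map hD hgc hM.exog
  filter_upwards [hae] with v hv x hx x' hx'
  -- Both sides are continuous in `y` and agree for almost every `y`. A discrepancy at one point
  -- would persist on a neighbourhood, which has positive probability by full support.
  have hq : ∀ α ∈ Ioo (0 : ℝ) 1, ∀ y ∈ D,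
      M.condQuantile α y v = sInf {h : ℝ | α ≤ cdf (κ v) h} + M.g y := by
    intro α hα y hy
    by_contra hne
    have hc : ContinuousAt (fun y => sInf {h : ℝ | α ≤ cdf (κ v) h} + M.g y) y :=
      continuousAt_const.add (hgc.continuousAt (hD.mem_nhds hy))
    have hev : ∀ᶠ z in nhds y, M.condQuantile α z v -
        (sInf {h : ℝ | α ≤ cdf (κ v) h} + M.g z) ≠ 0 :=
      ((M.continuousAt_condQuantile hD hM.reg hα v hy).sub hc).eventually_ne (sub_ne_zero.2 hne)
    have hpos := hM.fullSupport y hy _ hev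
    have hv' : ∀ᵐ ω ∂M.μ, M.X ω ∈ D ∧
        M.kerH (M.X ω, v) = (κ v).map (fun u => M.g (M.X ω) + u) :=
      ae_of_ae_map M.measurable_X.aemeasurable hv
    have hfreq := MeasureTheory.frequently_ae_mem_iff.2 hpos.ne'
    obtain ⟨ω, hω1, hω2⟩ := (hfreq.and_eventually hv').exists
    refine hω1 (sub_eq_zero.2 ?_)
    refine quantile_shift (fun h => ?_) hα
    rw [hω2.2, cdf_map_add]
  have hm : Measurable (fun u : ℝ => (M.g x' - M.g x) + u) := by fun_prop
  have : IsProbabilityMeasure ((M.kerH (x, v)).map (fun u => (M.g x' - M.g x) + u)) :=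
    Measure.isProbabilityMeasure_map hm.aemeasurable
  refine Measure.eq_of_cdf _ _ (StieltjesFunction.ext fun h => ?_)
  rw [cdf_map_add]
  refine cdf_eq_of_quantile_shift (fun α hα => ?_) h
  have h1 := hq α hα x hx
  have h2 := hq α hα x' hx'
  unfold condQuantile condCdf at h1 h2
  rw [h1, h2]
  ring

end Model

/-! ### Thresholds and response probabilities. -/

/-- One element below each admissible rational suffices, together with the least element if there is
one. -/
lemma exists_countable_coinitial (S : Set ℝ) :
    ∃ C ⊆ S, C.Countable ∧ ∀ h ∈ S, ∃ c ∈ C, c ≤ h := by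
  classical
  have hsel : ∀ q : {q : ℚ // ∃ s ∈ S, s < (q : ℝ)}, ∃ s ∈ S, s < ((q : ℚ) : ℝ) := fun q => q.2
  choose u hu hlt using hsel
  refine ⟨range u ∪ {s | IsLeast S s}, ?_, ?_, ?_⟩
  · rintro s (⟨q, rfl⟩ | hs)
    · exact hu q
    · exact hs.1
  · refine (countable_range u).union (Set.Subsingleton.countable ?_)
    exact fun a ha b hb => ha.unique hb
  · intro h hh
    by_cases hl : IsLeast S h
    · exact ⟨h, Or.inr hl, le_rfl⟩
    · have : ∃ s ∈ S, s < h := by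
        by_contra hcon
        push Not at hcon
        exact hl ⟨hh, hcon⟩
      obtain ⟨s, hs, hsh⟩ := this
      obtain ⟨q, hsq, hqh⟩ := exists_rat_btwn hsh
      exact ⟨u ⟨q, s, hs, hsq⟩, Or.inl ⟨_, rfl⟩, ((hlt _).trans hqh).le⟩

namespace Model

variable {J Rbar : ℕ} {D : Set (Cov J)} {Ω : Type*} [MeasurableSpace Ω]
  {𝒱 : Type*} [MeasurableSpace 𝒱]

/-- `r` is measurable only in `v` for each fixed `h`. Monotonicity in `h` lets a countable coinitial
set of outcomes decide whether the threshold exceeds `a`. -/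
lemma measurable_threshold (M : Model J Rbar D Ω 𝒱) (hM : M.Honest) (ρ : Fin (Rbar + 1)) :
    Measurable (fun v => M.threshold v ρ) := by
  refine measurable_of_Ioi fun a => ?_
  obtain ⟨C, hCS, hC, hcoi⟩ := exists_countable_coinitial {h | h ∈ M.latent ∧ a < (h : EReal)}
  have heq : (fun v => M.threshold v ρ) ⁻¹' Ioi a = ⋃ c ∈ C, {v | M.r c v ≤ ρ} := by
    ext v
    simp only [threshold, mem_preimage, mem_Ioi, lt_sSup_iff, mem_iUnion, mem_ofPred_eq,
      exists_mem_image, exists_prop]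
    constructor
    · rintro ⟨h, ⟨hl, hr⟩, hah⟩
      obtain ⟨c, hc, hch⟩ := hcoi h ⟨hl, hah⟩
      exact ⟨c, hc, ((hM v).1 (hCS hc).1 hl hch).trans hr⟩
    · rintro ⟨c, hc, hr⟩
      exact ⟨c, ⟨(hCS hc).1, hr⟩, (hCS hc).2⟩
  rw [heq]
  exact MeasurableSet.biUnion hC fun c hc => (M.measurable_r c (hCS hc).1) measurableSet_Iic

/-- Responses are discrete, so left-continuity makes `r(·,v)` constant just to the left of `h`
within `latent`. If `r h v > ρ`, outcomes with response at most `ρ` therefore stay a fixed distance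
below `h`. -/
lemma r_le_iff_le_threshold (M : Model J Rbar D Ω 𝒱) (hM : M.Honest) (ρ : Fin (Rbar + 1)) (v : 𝒱)
    {h : ℝ} (hh : h ∈ M.latent) : M.r h v ≤ ρ ↔ (h : EReal) ≤ M.threshold v ρ := by
  refine ⟨fun hr => le_sSup ⟨h, ⟨hh, hr⟩, rfl⟩, fun hle => ?_⟩
  by_contra hr
  have hlt : ∀ h' ∈ M.latent, M.r h' v ≤ ρ → h' < h := fun h' hl' hr' => by
    by_contra hge
    exact hr (((hM v).1 hh hl' (not_lt.1 hge)).trans hr')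
  have hev : ∀ᶠ h' in nhdsWithin h (M.latent ∩ Iic h), M.r h' v = M.r h v :=
    ((hM v).2 h hh).eventually_mem (isOpen_discrete {M.r h v} |>.mem_nhds rfl)
  rw [eventually_nhdsWithin_iff, Metric.eventually_nhds_iff] at hev
  obtain ⟨ε, hε, hball⟩ := hev
  have hlt' : ((h - ε : ℝ) : EReal) < M.threshold v ρ :=
    lt_of_lt_of_le (EReal.coe_lt_coe_iff.2 (by linarith)) hle
  obtain ⟨_, ⟨h', ⟨hl', hr'⟩, rfl⟩, hh'⟩ := lt_sSup_iff.1 hlt'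
  have h1 : h - ε < h' := EReal.coe_lt_coe_iff.1 hh'
  have h2 := hlt h' hl' hr'
  have := hball (y := h') (by rw [Real.dist_eq, abs_lt]; constructor <;> linarith) ⟨hl', h2.le⟩
  exact hr (this ▸ hr')

/-- The conditional probability of `H + s ≤ τ_v(ρ)` given `X = x`, `V = v`. -/
def respProb (M : Model J Rbar D Ω 𝒱) (ρ : Fin (Rbar + 1)) (s : ℝ) (x : Cov J) (v : 𝒱) : ℝ :=
  (M.kerH (x, v)).real {h : ℝ | ((s + h : ℝ) : EReal) ≤ M.threshold v ρ}

lemma measurable_respProb (M : Model J Rbar D Ω 𝒱) (hM : M.Honest) (ρ : Fin (Rbar + 1)) (s : ℝ) :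
    Measurable (fun p : Cov J × 𝒱 => M.respProb ρ s p.1 p.2) := by
  have := M.isMarkov
  have hset : MeasurableSet {q : (Cov J × 𝒱) × ℝ | ((s + q.2 : ℝ) : EReal) ≤
      M.threshold q.1.2 ρ} := by
    refine measurableSet_le ?_ ?_
    · exact measurable_coe_real_ereal.comp (by fun_prop)
    · exact (M.measurable_threshold hM ρ).comp (by fun_prop)
  exact (Kernel.measurable_kernel_prodMk_left (κ := M.kerH) hset).ennreal_toReal

lemma respProb_mem_Icc (M : Model J Rbar D Ω 𝒱) (ρ : Fin (Rbar + 1)) (s : ℝ) (x : Cov J) (v : 𝒱) :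
    M.respProb ρ s x v ∈ Icc (0 : ℝ) 1 := by
  have := M.isMarkov
  exact ⟨measureReal_nonneg, measureReal_le_one⟩

lemma respProb_of_eq_bot (M : Model J Rbar D Ω 𝒱) {ρ : Fin (Rbar + 1)} (s : ℝ) (x : Cov J) {v : 𝒱}
    (h : M.threshold v ρ = ⊥) : M.respProb ρ s x v = 0 := by
  have : {u : ℝ | ((s + u : ℝ) : EReal) ≤ M.threshold v ρ} = ∅ := by
    ext u
    simp only [h, le_bot_iff, EReal.coe_ne_bot, mem_ofPred_eq, mem_empty_iff_false]
  rw [respProb, this]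
  simp

lemma respProb_of_eq_top (M : Model J Rbar D Ω 𝒱) {ρ : Fin (Rbar + 1)} (s : ℝ) (x : Cov J) {v : 𝒱}
    (h : M.threshold v ρ = ⊤) : M.respProb ρ s x v = 1 := by
  have := M.isMarkov
  have : {u : ℝ | ((s + u : ℝ) : EReal) ≤ M.threshold v ρ} = univ := by
    ext u
    simp [h]
  rw [respProb, this]
  simp

lemma respProb_of_eq_coe (M : Model J Rbar D Ω 𝒱) {ρ : Fin (Rbar + 1)} (s : ℝ) (x : Cov J) {v : 𝒱}
    {t : ℝ} (h : M.threshold v ρ = t) : M.respProb ρ s x v = M.condCdf x v (t - s) := by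
  have := M.isMarkov
  have : {u : ℝ | ((s + u : ℝ) : EReal) ≤ M.threshold v ρ} = Iic (t - s) := by
    ext u
    rw [h, mem_ofPred_eq, EReal.coe_le_coe_iff, mem_Iic, le_sub_iff_add_le']
  rw [respProb, this, condCdf, cdf_eq_real]

lemma condDensity_nonneg (M : Model J Rbar D Ω 𝒱) (x : Cov J) (v : 𝒱) (h : ℝ) :
    0 ≤ M.condDensity x v h :=
  (monotone_cdf (M.kerH (x, v))).deriv_nonneg

lemma condDensityE_nonneg (M : Model J Rbar D Ω 𝒱) (x : Cov J) (v : 𝒱) (t : EReal) :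
    0 ≤ M.condDensityE x v t := by
  unfold condDensityE
  split_ifs
  · exact le_rfl
  · exact M.condDensity_nonneg x v _

/-- At an infinite threshold the probability is constantly 0 or 1, which matches the convention that
the density vanishes there. -/
lemma hasDerivAt_respProb (M : Model J Rbar D Ω 𝒱) {x : Cov J} {v : 𝒱}
    (hF : Differentiable ℝ (M.condCdf x v)) (ρ : Fin (Rbar + 1)) :
    HasDerivAt (fun s => M.respProb ρ s x v) (-M.condDensityE x v (M.threshold v ρ)) 0 := by
  rcases hτ : M.threshold v ρ with _ | _ | t
  · have h : M.threshold v ρ = ⊥ := hτ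
    have h' : M.condDensityE x v ⊥ = 0 := by simp [condDensityE]
    simp_rw [M.respProb_of_eq_bot _ x h]
    exact (hasDerivAt_const _ _).congr_deriv (by rw [← neg_zero, ← h']; rfl)
  · have h : M.threshold v ρ = ⊤ := hτ
    have h' : M.condDensityE x v ⊤ = 0 := by simp [condDensityE]
    simp_rw [M.respProb_of_eq_top _ x h]
    exact (hasDerivAt_const _ _).congr_deriv (by rw [← neg_zero, ← h']; rfl)
  · have h : M.threshold v ρ = (t : EReal) := hτ
    have h' : M.condDensityE x v (t : EReal) = M.condDensity x v t := by simp [condDensityE]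
    simp_rw [M.respProb_of_eq_coe _ x h]
    have h1 : HasDerivAt (M.condCdf x v) (M.condDensity x v t) (t - 0) := by
      rw [sub_zero]; exact (hF t).hasDerivAt
    exact (h1.comp_const_sub t 0).congr_deriv (by rw [← h']; rfl)

/-- The constant depends only on the density bound `c`; for `c` uniform in `v` it gives the
domination needed to differentiate under the integral. -/
lemma lipschitzWith_respProb (M : Model J Rbar D Ω 𝒱) {x : Cov J} {v : 𝒱}
    (hF : Differentiable ℝ (M.condCdf x v)) {c : ℝ} (hc : ∀ h, M.condDensity x v h ≤ c)
    (ρ : Fin (Rbar + 1)) : LipschitzWith (Real.nnabs c) (fun s => M.respProb ρ s x v) := by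
  rcases hτ : M.threshold v ρ with _ | _ | t
  · simp_rw [M.respProb_of_eq_bot _ x hτ]
    exact LipschitzWith.const' _
  · simp_rw [M.respProb_of_eq_top _ x hτ]
    exact LipschitzWith.const' _
  · have h : M.threshold v ρ = (t : EReal) := hτ
    simp_rw [M.respProb_of_eq_coe _ x h]
    have hl : LipschitzWith (Real.nnabs c) (M.condCdf x v) := by
      refine lipschitzWith_of_nnnorm_deriv_le hF fun s => ?_
      have h0 : 0 ≤ deriv (M.condCdf x v) s := M.condDensity_nonneg x v s
      rw [← NNReal.coe_le_coe, coe_nnnorm, Real.coe_nnabs, Real.norm_of_nonneg h0]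
      exact (hc s).trans (le_abs_self c)
    have hsub : LipschitzWith 1 (fun s : ℝ => t - s) :=
      LipschitzWith.of_dist_le_mul fun a b => by
        rw [Real.dist_eq, Real.dist_eq, sub_sub_sub_cancel_left, abs_sub_comm b a]; simp
    simpa [Function.comp_def] using hl.comp hsub

open Filter Topology in
-- Up to sign the density at the threshold is a limit of difference quotients of response
-- probabilities, which are measurable in `v`.
lemma measurable_condDensityE_threshold (M : Model J Rbar D Ω 𝒱) (hM : M.Honest) {x : Cov J}
    (hF : ∀ v, Differentiable ℝ (M.condCdf x v)) (ρ : Fin (Rbar + 1)) :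
    Measurable (fun v => M.condDensityE x v (M.threshold v ρ)) := by
  have hmeas : ∀ s, Measurable (fun v => M.respProb ρ s x v) := fun s =>
    (M.measurable_respProb hM ρ s).comp measurable_prodMk_left
  have hu : Tendsto (fun n : ℕ => 1 / ((n : ℝ) + 1)) atTop (𝓝[≠] 0) := by
    refine tendsto_nhdsWithin_iff.2 ⟨tendsto_one_div_add_atTop_nhds_zero_nat, ?_⟩
    exact Eventually.of_forall fun n => (by positivity : (1 : ℝ) / ((n : ℝ) + 1) ≠ 0)
  have hneg : Measurable (fun v => -M.condDensityE x v (M.threshold v ρ)) := by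
    refine measurable_of_tendsto_metrizable (f := fun (n : ℕ) v => (1 / ((n : ℝ) + 1))⁻¹ •
      (M.respProb ρ (0 + 1 / ((n : ℝ) + 1)) x v - M.respProb ρ 0 x v)) (fun n => ?_) ?_
    · exact ((hmeas _).sub (hmeas 0)).const_mul _
    · rw [tendsto_pi_nhds]
      intro v
      exact (hasDerivAt_iff_tendsto_slope_zero.1 (M.hasDerivAt_respProb (hF v) ρ)).comp hu
  simpa only [Pi.neg_def, neg_neg] using hneg.neg

/-! ### The mean response and its gradient. -/

/-- The expected weight at `x`. -/
def meanWeight (M : Model J Rbar D Ω 𝒱) (x : Cov J) : ℝ :=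
  ∫ v, M.weight x v ∂(M.μ.map M.V)

/-- The mean response given `X = x`, as an integral over types. -/
def meanResponse (M : Model J Rbar D Ω 𝒱) (x : Cov J) : ℝ :=
  ∑ ρ : Fin Rbar, (1 - ∫ v, M.respProb ρ.castSucc 0 x v ∂(M.μ.map M.V))

lemma integrable_respProb (M : Model J Rbar D Ω 𝒱) (hM : M.Honest) (ρ : Fin (Rbar + 1)) (s : ℝ)
    (x : Cov J) : Integrable (fun v => M.respProb ρ s x v) (M.μ.map M.V) := by
  refine Integrable.of_mem_Icc 0 1 ?_ ?_
  · exact ((M.measurable_respProb hM ρ s).comp measurable_prodMk_left).aemeasurable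
  · exact Filter.Eventually.of_forall fun v => M.respProb_mem_Icc ρ s x v

lemma hasDerivAt_integral_respProb (M : Model J Rbar D Ω 𝒱) (hM : M.Honest) {x : Cov J}
    (hF : ∀ v, Differentiable ℝ (M.condCdf x v)) {c : ℝ} (hc : ∀ v h, M.condDensity x v h ≤ c)
    (ρ : Fin (Rbar + 1)) :
    Integrable (fun v => M.condDensityE x v (M.threshold v ρ)) (M.μ.map M.V) ∧
    HasDerivAt (fun s => ∫ v, M.respProb ρ s x v ∂(M.μ.map M.V))
      (-∫ v, M.condDensityE x v (M.threshold v ρ) ∂(M.μ.map M.V)) 0 := by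
  have h := hasDerivAt_integral_of_dominated_loc_of_lip (μ := M.μ.map M.V) (s := univ)
    (F := fun s v => M.respProb ρ s x v) (x₀ := (0 : ℝ))
    (F' := fun v => -M.condDensityE x v (M.threshold v ρ)) (bound := fun _ => c)
    Filter.univ_mem
    (Filter.Eventually.of_forall fun s => (M.integrable_respProb hM ρ s x).aestronglyMeasurable)
    (M.integrable_respProb hM ρ 0 x)
    (M.measurable_condDensityE_threshold hM hF ρ).neg.aestronglyMeasurable
    (Filter.Eventually.of_forall fun v =>
      (M.lipschitzWith_respProb (hF v) (hc v) ρ).lipschitzOnWith)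
    (integrable_const c)
    (Filter.Eventually.of_forall fun v => M.hasDerivAt_respProb (hF v) ρ)
  refine ⟨by simpa using h.1.neg, ?_⟩
  rw [← integral_neg]
  exact h.2

lemma weight_nonneg (M : Model J Rbar D Ω 𝒱) (x : Cov J) (v : 𝒱) : 0 ≤ M.weight x v :=
  Finset.sum_nonneg fun _ _ => M.condDensityE_nonneg x v _

variable [StandardBorelSpace Ω]

/-- The density conditions do not involve `j`, so any index serves; the nonvanishing partial
derivative supplies one. -/
lemma Assumptions.exists_reg {M : Model J Rbar D Ω 𝒱} (hM : M.Assumptions) : ∃ j, M.Reg j :=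
  ⟨hM.structural.partial_ne_zero.choose, hM.reg _⟩

lemma meanWeight_pos (M : Model J Rbar D Ω 𝒱) (hM : M.Assumptions) {x : Cov J} (hx : x ∈ D) :
    0 < M.meanWeight x := by
  obtain ⟨j, hj⟩ := hM.exists_reg
  obtain ⟨c, hc⟩ := hj.density_bounded x hx
  have hint : Integrable (fun v => M.weight x v) (M.μ.map M.V) :=
    integrable_finsetSum _ fun ρ _ => (M.hasDerivAt_integral_respProb hM.honest
      (hj.latent_continuous x hx) hc ρ.castSucc).1
  refine lt_of_le_of_ne (integral_nonneg (M.weight_nonneg x)) fun h0 => ?_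
  have hz := (integral_eq_zero_iff_of_nonneg (M.weight_nonneg x) hint).1 h0.symm
  have hz' := ae_of_ae_map M.measurable_V.aemeasurable hz
  have hpos := hM.positiveWeight x hx
  refine hpos.ne' ?_
  refine measure_mono_null (fun ω hω => ?_) (ae_iff.1 hz')
  exact ne_of_gt hω

/-- With `x` fixed, `x'` enters only through the number `g x' - g x`, so the gradient follows from a
one-variable derivative and the chain rule. -/
lemma meanResponse_eq (M : Model J Rbar D Ω 𝒱) (hD : IsOpen D) (hM : M.Assumptions) {x : Cov J}
    (hx : x ∈ D) {x' : Cov J} (hx' : x' ∈ D) :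
    M.meanResponse x' = ∑ ρ : Fin Rbar,
      (1 - ∫ v, M.respProb ρ.castSucc (M.g x' - M.g x) x v ∂(M.μ.map M.V)) := by
  refine Finset.sum_congr rfl fun ρ _ => ?_
  congr 1
  refine integral_congr_ae ?_
  filter_upwards [M.ae_kerH_shift hD hM] with v hv
  have hm : Measurable (fun u : ℝ => (M.g x' - M.g x) + u) := by fun_prop
  rw [respProb, hv x hx x' hx', map_measureReal_apply hm, respProb]
  · simp
  · exact measurableSet_le (measurable_coe_real_ereal.comp (by fun_prop)) measurable_const

/-- The gradient of the mean response is a positive multiple of the gradient of `g`. -/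
lemma hasFDerivAt_meanResponse (M : Model J Rbar D Ω 𝒱) (hD : IsOpen D) (hM : M.Assumptions)
    {x : Cov J} (hx : x ∈ D) :
    HasFDerivAt M.meanResponse (M.meanWeight x • fderiv ℝ M.g x) x := by
  obtain ⟨j, hj⟩ := hM.exists_reg
  obtain ⟨c, hc⟩ := hj.density_bounded x hx
  have key := fun ρ : Fin Rbar => M.hasDerivAt_integral_respProb hM.honest
    (hj.latent_continuous x hx) hc ρ.castSucc
  have hΦ : HasDerivAt (fun s => ∑ ρ : Fin Rbar,
      (1 - ∫ v, M.respProb ρ.castSucc s x v ∂(M.μ.map M.V))) (M.meanWeight x)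
      (M.g x - M.g x) := by
    rw [sub_self]
    refine (HasDerivAt.fun_sum (u := Finset.univ)
      fun ρ _ => ((key ρ).2.const_sub 1)).congr_deriv ?_
    simp only [neg_neg]
    exact (integral_finsetSum _ fun ρ _ => (key ρ).1).symm
  have hg : HasFDerivAt (fun y => M.g y - M.g x) (fderiv ℝ M.g x) x :=
    ((hM.structural.contDiff.differentiableOn one_ne_zero).differentiableAt
      (hD.mem_nhds hx)).hasFDerivAt.sub_const _
  refine (HasDerivAt.comp_hasFDerivAt x hΦ hg).congr_of_eventuallyEq ?_
  filter_upwards [hD.mem_nhds hx] with y hy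
  exact M.meanResponse_eq hD hM hx hy

end Model

/-! ### The mean response is the regression function. -/

lemma val_eq_sum_one_sub_ite {n : ℕ} (r : Fin (n + 1)) :
    ((r : ℕ) : ℝ) = ∑ ρ : Fin n, (1 - if r ≤ ρ.castSucc then (1 : ℝ) else 0) := by
  have h : ∀ ρ : Fin n, (1 - if r ≤ ρ.castSucc then (1 : ℝ) else 0) =
      if (ρ : ℕ) < r then (1 : ℝ) else 0 := by
    intro ρ
    by_cases hρ : (ρ : ℕ) < r
    · have : ¬ r ≤ ρ.castSucc := by rw [Fin.le_def]; simpa using hρ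
      simp [hρ, this]
    · have : r ≤ ρ.castSucc := by rw [Fin.le_def]; simpa using hρ
      simp [hρ, this]
  simp_rw [h]
  rw [Fin.sum_univ_eq_sum_range (fun i => if i < (r : ℕ) then (1 : ℝ) else 0) n, Finset.sum_boole]
  have : Finset.filter (fun i => i < (r : ℕ)) (Finset.range n) = Finset.range r := by
    ext i
    have := r.2
    simp only [Finset.mem_filter, Finset.mem_range]
    omega
  rw [this, Finset.card_range]

namespace Model

variable {J Rbar : ℕ} {D : Set (Cov J)} {Ω : Type*} [MeasurableSpace Ω]
  {𝒱 : Type*} [MeasurableSpace 𝒱]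

instance (M : Model J Rbar D Ω 𝒱) : IsProbabilityMeasure (M.μ.map M.X) :=
  Measure.isProbabilityMeasure_map M.measurable_X.aemeasurable

instance (M : Model J Rbar D Ω 𝒱) : IsProbabilityMeasure (M.μ.map M.V) :=
  Measure.isProbabilityMeasure_map M.measurable_V.aemeasurable

lemma aemeasurable_H (M : Model J Rbar D Ω 𝒱) : AEMeasurable M.H M.μ :=
  M.hasCondDistrib.aemeasurable_snd

lemma R_le_iff (M : Model J Rbar D Ω 𝒱) (hM : M.Honest) (ρ : Fin (Rbar + 1)) (ω : Ω) :
    M.R ω ≤ ρ ↔ (M.H ω : EReal) ≤ M.threshold (M.V ω) ρ :=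
  M.r_le_iff_le_threshold hM ρ (M.V ω) (M.H_mem ω)

/-- `r` is not assumed jointly measurable; the threshold description replaces this. Null sets enter
because `H` is only almost everywhere measurable. -/
lemma nullMeasurableSet_R_le (M : Model J Rbar D Ω 𝒱) (hM : M.Honest) (ρ : Fin (Rbar + 1)) :
    NullMeasurableSet {ω | M.R ω ≤ ρ} M.μ := by
  simp_rw [M.R_le_iff hM ρ]
  exact nullMeasurableSet_le (measurable_coe_real_ereal.comp_aemeasurable M.aemeasurable_H)
    ((M.measurable_threshold hM ρ).comp M.measurable_V).aemeasurable

lemma aemeasurable_R (M : Model J Rbar D Ω 𝒱) (hM : M.Honest) : AEMeasurable M.R M.μ := by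
  have hle := M.nullMeasurableSet_R_le hM
  refine NullMeasurable.aemeasurable fun s _ => ?_
  have hs : M.R ⁻¹' s = ⋃ ρ ∈ s, ({ω | M.R ω ≤ ρ} \ ⋃ ρ' ∈ Iio ρ, {ω | M.R ω ≤ ρ'}) := by
    ext ω
    simp only [mem_preimage, mem_iUnion, mem_sdiff, mem_ofPred_eq, mem_Iio, exists_prop, not_exists,
      not_and, not_le]
    constructor
    · exact fun h => ⟨_, h, le_rfl, fun _ h => h⟩
    · rintro ⟨ρ, hρ, h1, h2⟩
      rcases h1.lt_or_eq with h | h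
      · exact absurd (h2 _ h) (lt_irrefl _)
      · rwa [h]
  rw [hs]
  refine NullMeasurableSet.biUnion (to_countable _) fun ρ _ => (hle ρ).diff ?_
  exact NullMeasurableSet.biUnion (to_countable _) fun ρ' _ => hle ρ'

lemma integrable_R (M : Model J Rbar D Ω 𝒱) (hM : M.Honest) :
    Integrable (fun ω => ((M.R ω : ℕ) : ℝ)) M.μ := by
  refine Integrable.of_mem_Icc 0 Rbar ?_ (Filter.Eventually.of_forall fun ω => ?_)
  · exact (measurable_of_finite (fun r : Fin (Rbar + 1) => ((r : ℕ) : ℝ))).comp_aemeasurable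
      (M.aemeasurable_R hM)
  · exact ⟨by positivity, by exact_mod_cast Nat.lt_succ_iff.1 (M.R ω).2⟩

lemma measurable_integral_respProb (M : Model J Rbar D Ω 𝒱) (hM : M.Honest)
    (ρ : Fin (Rbar + 1)) : Measurable (fun x => ∫ v, M.respProb ρ 0 x v ∂(M.μ.map M.V)) :=
  ((M.measurable_respProb hM ρ 0).stronglyMeasurable.integral_prod_right').measurable

lemma integral_respProb_mem_Icc (M : Model J Rbar D Ω 𝒱) (hM : M.Honest) (ρ : Fin (Rbar + 1))
    (x : Cov J) : ∫ v, M.respProb ρ 0 x v ∂(M.μ.map M.V) ∈ Icc (0 : ℝ) 1 := by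
  refine ⟨integral_nonneg fun v => (M.respProb_mem_Icc ρ 0 x v).1, ?_⟩
  have := integral_mono (M.integrable_respProb hM ρ 0 x) (integrable_const (1 : ℝ))
    fun v => (M.respProb_mem_Icc ρ 0 x v).2
  simpa using this

lemma measurable_meanResponse (M : Model J Rbar D Ω 𝒱) (hM : M.Honest) :
    Measurable M.meanResponse :=
  Finset.measurable_fun_sum _ fun ρ _ => (M.measurable_integral_respProb hM ρ.castSucc).const_sub 1

lemma meanResponse_mem_Icc (M : Model J Rbar D Ω 𝒱) (hM : M.Honest) (x : Cov J) :
    M.meanResponse x ∈ Icc (0 : ℝ) Rbar := by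
  have h := fun ρ : Fin Rbar => M.integral_respProb_mem_Icc hM ρ.castSucc x
  refine ⟨Finset.sum_nonneg fun ρ _ => sub_nonneg.2 (h ρ).2, ?_⟩
  calc M.meanResponse x ≤ ∑ _ρ : Fin Rbar, (1 : ℝ) :=
        Finset.sum_le_sum fun ρ _ => sub_le_self _ (h ρ).1
    _ = Rbar := by simp

/-- The joint probability of `X ∈ A` and `R ≤ ρ`. -/
lemma measureReal_inter_R_le (M : Model J Rbar D Ω 𝒱) (hM : M.Honest)
    (hind : IndepFun M.X M.V M.μ) (ρ : Fin (Rbar + 1)) {A : Set (Cov J)} (hA : MeasurableSet A) :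
    M.μ.real ({ω | M.R ω ≤ ρ} ∩ M.X ⁻¹' A) =
      ∫ x in A, ∫ v, M.respProb ρ 0 x v ∂(M.μ.map M.V) ∂(M.μ.map M.X) := by
  have := M.isMarkov
  have hXV : AEMeasurable (fun ω => (M.X ω, M.V ω)) M.μ :=
    (M.measurable_X.prodMk M.measurable_V).aemeasurable
  set T : Set ((Cov J × 𝒱) × ℝ) := {q | ((q.2 : ℝ) : EReal) ≤ M.threshold q.1.2 ρ ∧ q.1.1 ∈ A}
    with hT
  have hTm : MeasurableSet T := by
    have h1 : MeasurableSet {q : (Cov J × 𝒱) × ℝ | ((q.2 : ℝ) : EReal) ≤ M.threshold q.1.2 ρ} :=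
      measurableSet_le (measurable_coe_real_ereal.comp (by fun_prop))
        ((M.measurable_threshold hM ρ).comp (by fun_prop))
    exact h1.inter ((by fun_prop : Measurable fun q : (Cov J × 𝒱) × ℝ => q.1.1) hA)
  have hpre : {ω | M.R ω ≤ ρ} ∩ M.X ⁻¹' A = (fun ω => ((M.X ω, M.V ω), M.H ω)) ⁻¹' T := by
    ext ω
    simp [hT, M.R_le_iff hM ρ ω]
  have hlaw : M.μ.map (fun ω => ((M.X ω, M.V ω), M.H ω)) =
      ((M.μ.map M.X).prod (M.μ.map M.V)) ⊗ₘ M.kerH := by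
    rw [← (indepFun_iff_map_prod_eq_prod_map_map M.measurable_X.aemeasurable
      M.measurable_V.aemeasurable).1 hind]
    exact M.hasCondDistrib.map_eq
  -- Conditionally on `(X,V)`, the event is the response event with shift `0`.
  have hfib : ∀ p : Cov J × 𝒱, (M.kerH p).real (Prod.mk p ⁻¹' T) =
      A.indicator (fun x => M.respProb ρ 0 x p.2) p.1 := by
    rintro ⟨x, v⟩
    by_cases hx : x ∈ A
    · have : Prod.mk (x, v) ⁻¹' T = {h : ℝ | ((0 + h : ℝ) : EReal) ≤ M.threshold v ρ} := by
        ext h; simp [hT, hx]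
      rw [this, indicator_of_mem hx]
      rfl
    · have : Prod.mk (x, v) ⁻¹' T = ∅ := by ext h; simp [hT, hx]
      rw [this, indicator_of_notMem hx, measureReal_empty]
  have hmeas : Measurable (fun p : Cov J × 𝒱 => A.indicator (fun x => M.respProb ρ 0 x p.2) p.1) := by
    simp_rw [← hfib]
    exact (Kernel.measurable_kernel_prodMk_left hTm).ennreal_toReal
  rw [hpre, Measure.real, ← Measure.map_apply_of_aemeasurable (hXV.prodMk M.aemeasurable_H) hTm,
    hlaw, Measure.compProd_apply hTm, ← integral_toReal
      (Kernel.measurable_kernel_prodMk_left hTm).aemeasurable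
      (Filter.Eventually.of_forall fun p => measure_lt_top _ _)]
  change ∫ p, (M.kerH p).real (Prod.mk p ⁻¹' T) ∂((M.μ.map M.X).prod (M.μ.map M.V)) = _
  simp_rw [hfib]
  rw [integral_prod, ← integral_indicator hA]
  · refine integral_congr_ae (Filter.Eventually.of_forall fun x => ?_)
    by_cases hx : x ∈ A
    · simp [hx]
    · simp [hx]
  · refine Integrable.of_mem_Icc 0 1 hmeas.aemeasurable (Filter.Eventually.of_forall fun p => ?_)
    by_cases hx : p.1 ∈ A
    · rw [indicator_of_mem hx]; exact M.respProb_mem_Icc ρ 0 p.1 p.2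
    · rw [indicator_of_notMem hx]; exact ⟨le_rfl, zero_le_one⟩

lemma setIntegral_meanResponse (M : Model J Rbar D Ω 𝒱) (hM : M.Honest)
    (hind : IndepFun M.X M.V M.μ) {A : Set (Cov J)} (hA : MeasurableSet A) :
    ∫ ω in M.X ⁻¹' A, M.meanResponse (M.X ω) ∂M.μ =
      ∫ ω in M.X ⁻¹' A, ((M.R ω : ℕ) : ℝ) ∂M.μ := by
  have hnull := M.nullMeasurableSet_R_le hM
  have hint : ∀ ρ : Fin (Rbar + 1), Integrable (fun ω => if M.R ω ≤ ρ then (1 : ℝ) else 0)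
      (M.μ.restrict (M.X ⁻¹' A)) := fun ρ =>
    ((integrable_const (1 : ℝ)).indicator₀ ((hnull ρ).mono_ac
      Measure.restrict_le_self.absolutelyContinuous)).congr
      (Filter.Eventually.of_forall fun ω => by simp [indicator_apply])
  have hintX : ∀ ρ : Fin (Rbar + 1), Integrable
      (fun ω => ∫ v, M.respProb ρ 0 (M.X ω) v ∂(M.μ.map M.V)) (M.μ.restrict (M.X ⁻¹' A)) := fun ρ =>
    Integrable.of_mem_Icc 0 1
      ((M.measurable_integral_respProb hM ρ).comp M.measurable_X).aemeasurable
      (Filter.Eventually.of_forall fun ω => M.integral_respProb_mem_Icc hM ρ (M.X ω))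
  simp_rw [val_eq_sum_one_sub_ite, meanResponse]
  rw [integral_finsetSum _ fun ρ _ => by exact (integrable_const _).sub (hintX ρ.castSucc),
    integral_finsetSum _ fun ρ _ => by exact (integrable_const _).sub (hint ρ.castSucc)]
  refine Finset.sum_congr rfl fun ρ _ => ?_
  rw [integral_sub (integrable_const _) (hintX _), integral_sub (integrable_const _) (hint _)]
  congr 1
  rw [← setIntegral_map hA (M.measurable_integral_respProb hM ρ.castSucc).aestronglyMeasurable
    M.measurable_X.aemeasurable, ← M.measureReal_inter_R_le hM hind _ hA]
  have h1 : ∀ ω, (if M.R ω ≤ ρ.castSucc then (1 : ℝ) else 0) =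
      {ω | M.R ω ≤ ρ.castSucc}.indicator (fun _ => (1 : ℝ)) ω := fun ω => by simp [indicator_apply]
  simp_rw [h1]
  rw [integral_indicator₀ ((hnull _).mono_ac Measure.restrict_le_self.absolutelyContinuous)]
  simp only [integral_const, smul_eq_mul, mul_one, measureReal_restrict_apply MeasurableSet.univ,
    univ_inter]
  rw [measureReal_def, measureReal_def, Measure.restrict_apply₀ ((hnull _).mono_ac
      Measure.restrict_le_self.absolutelyContinuous)]

lemma isRegression_of_setIntegral_eq (M : Model J Rbar D Ω 𝒱) (hM : M.Honest) {m : Cov J → ℝ}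
    (hc : ContinuousOn m D) (hm : Measurable m) (hint : Integrable (fun ω => m (M.X ω)) M.μ)
    (h : ∀ A, MeasurableSet A → ∫ ω in M.X ⁻¹' A, m (M.X ω) ∂M.μ =
      ∫ ω in M.X ⁻¹' A, ((M.R ω : ℕ) : ℝ) ∂M.μ) : M.IsRegression m := by
  refine ⟨hc, ae_eq_condExp_of_forall_setIntegral_eq M.measurable_X.comap_le (M.integrable_R hM)
    (fun s _ _ => hint.integrableOn) ?_ ?_⟩
  · rintro s ⟨A, hA, rfl⟩ _
    exact h A hA
  · exact (hm.comp (comap_measurable M.X)).aestronglyMeasurable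

lemma IsRegression.eqOn {M : Model J Rbar D Ω 𝒱} (hD : IsOpen D) (hM : M.FullSupport)
    {m m' : Cov J → ℝ} (hm : M.IsRegression m) (hm' : M.IsRegression m') : EqOn m m' D := by
  intro x hx
  by_contra hne
  have hev : ∀ᶠ y in nhds x, m y - m' y ≠ 0 := ((hm.1.continuousAt (hD.mem_nhds hx)).sub
    (hm'.1.continuousAt (hD.mem_nhds hx))).eventually_ne (sub_ne_zero.2 hne)
  have hpos := hM x hx _ hev
  obtain ⟨ω, hω1, hω2⟩ := ((frequently_ae_mem_iff.2 hpos.ne').and_eventually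
    (hm.2.trans hm'.2.symm)).exists
  exact hω1 (sub_eq_zero.2 hω2)

variable [StandardBorelSpace Ω]

lemma continuousOn_meanResponse (M : Model J Rbar D Ω 𝒱) (hD : IsOpen D) (hM : M.Assumptions) :
    ContinuousOn M.meanResponse D := fun _ hx =>
  (M.hasFDerivAt_meanResponse hD hM hx).continuousAt.continuousWithinAt

lemma isRegression_meanResponse (M : Model J Rbar D Ω 𝒱) (hD : IsOpen D) (hM : M.Assumptions) :
    M.IsRegression M.meanResponse := by
  refine M.isRegression_of_setIntegral_eq hM.honest (M.continuousOn_meanResponse hD hM)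
    (M.measurable_meanResponse hM.honest) ?_
    fun A hA => M.setIntegral_meanResponse hM.honest hM.exog.1 hA
  exact Integrable.of_mem_Icc 0 Rbar
    ((M.measurable_meanResponse hM.honest).comp M.measurable_X).aemeasurable
    (Filter.Eventually.of_forall fun ω => M.meanResponse_mem_Icc hM.honest (M.X ω))

/-- The regression function is determined by the distribution of `(R, X)`. -/
lemma isRegression_meanResponse_of_observedLaw_eq (M : Model J Rbar D Ω 𝒱) (hD : IsOpen D)
    (hM : M.Assumptions) {Ω' : Type*} [MeasurableSpace Ω'] {𝒱' : Type*} [MeasurableSpace 𝒱']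
    (M' : Model J Rbar D Ω' 𝒱') (hM' : M'.Honest) (hlaw : M'.observedLaw = M.observedLaw) :
    M'.IsRegression M.meanResponse := by
  have hmm := M.measurable_meanResponse hM.honest
  have hval : Measurable (fun r : Fin (Rbar + 1) => ((r : ℕ) : ℝ)) := measurable_of_finite _
  refine M'.isRegression_of_setIntegral_eq hM' (M.continuousOn_meanResponse hD hM) hmm ?_
    fun A hA => ?_
  · exact Integrable.of_mem_Icc 0 Rbar (hmm.comp M'.measurable_X).aemeasurable
      (Filter.Eventually.of_forall fun ω => M.meanResponse_mem_Icc hM.honest (M'.X ω))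
  have hA2 : MeasurableSet (Prod.snd ⁻¹' A : Set (Fin (Rbar + 1) × Cov J)) := measurable_snd hA
  have hae : AEMeasurable (fun ω => (M.R ω, M.X ω)) M.μ :=
    (M.aemeasurable_R hM.honest).prodMk M.measurable_X.aemeasurable
  have hae' : AEMeasurable (fun ω => (M'.R ω, M'.X ω)) M'.μ :=
    (M'.aemeasurable_R hM').prodMk M'.measurable_X.aemeasurable
  -- The integrals characterising the conditional expectation involve only functions of `(R, X)`, so
  -- they transfer between the models.
  have tr : ∀ f : Fin (Rbar + 1) × Cov J → ℝ, Measurable f →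
      ∫ ω in M'.X ⁻¹' A, f (M'.R ω, M'.X ω) ∂M'.μ = ∫ ω in M.X ⁻¹' A, f (M.R ω, M.X ω) ∂M.μ := by
    intro f hf
    have h1 := setIntegral_map hA2 (hf.aestronglyMeasurable (μ := M'.observedLaw)) hae'
    have h2 := setIntegral_map hA2 (hf.aestronglyMeasurable (μ := M.observedLaw)) hae
    change ∫ y in _, f y ∂M'.observedLaw = _ at h1
    change ∫ y in _, f y ∂M.observedLaw = _ at h2
    rw [hlaw, h2] at h1
    exact h1.symm
  have h1 := tr (fun p => M.meanResponse p.2) (hmm.comp measurable_snd)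
  have h2 := tr (fun p => ((p.1 : ℕ) : ℝ)) (hval.comp measurable_fst)
  simp only at h1 h2
  rw [h1, h2]
  exact M.setIntegral_meanResponse hM.honest hM.exog.1 hA

/-! ### Recovery of `g` and identification up to scale. -/

lemma IsRegression.hasFDerivAt {M : Model J Rbar D Ω 𝒱} (hD : IsOpen D) (hM : M.Assumptions)
    {m : Cov J → ℝ} (hm : M.IsRegression m) {x : Cov J} (hx : x ∈ D) :
    HasFDerivAt m (M.meanWeight x • fderiv ℝ M.g x) x := by
  refine (M.hasFDerivAt_meanResponse hD hM hx).congr_of_eventuallyEq ?_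
  filter_upwards [hD.mem_nhds hx] with y hy
  exact hm.eqOn hD hM.fullSupport (M.isRegression_meanResponse hD hM) hy

lemma Assumptions.differentiableAt {M : Model J Rbar D Ω 𝒱} (hM : M.Assumptions) (hD : IsOpen D)
    {x : Cov J} (hx : x ∈ D) : DifferentiableAt ℝ M.g x :=
  (hM.structural.contDiff.differentiableOn one_ne_zero).differentiableAt (hD.mem_nhds hx)

lemma IsRegression.partialD_eq {M : Model J Rbar D Ω 𝒱} (hD : IsOpen D) (hM : M.Assumptions)
    {m : Cov J → ℝ} (hm : M.IsRegression m) {x : Cov J} (hx : x ∈ D) (j : Fin J) :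
    partialD m j x = M.meanWeight x * partialD M.g j x := by
  have h := hm.hasFDerivAt hD hM hx
  rw [partialD_eq_fderiv h.differentiableAt, h.fderiv,
    partialD_eq_fderiv (hM.differentiableAt hD hx)]
  rfl

lemma IsRegression.ratio_eq {M : Model J Rbar D Ω 𝒱} (hD : IsOpen D) (hM : M.Assumptions)
    {m : Cov J → ℝ} (hm : M.IsRegression m) {x : Cov J} (hx : x ∈ D) (k j : Fin J) :
    ratio M.g k j x = ratio m k j x := by
  rw [ratio, ratio, hm.partialD_eq hD hM hx, hm.partialD_eq hD hM hx,
    mul_div_mul_left _ _ (M.meanWeight_pos hM hx).ne']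

/-- This is Euler's identity divided by `∂_k g`, with the ratios then expressed through `m`. -/
lemma IsRegression.div_partialD_eq_eulerSum {M : Model J Rbar D Ω 𝒱} (hD : IsOpen D)
    (hM : M.Assumptions) {m : Cov J → ℝ} (hm : M.IsRegression m) {x : Cov J} (hx : x ∈ D)
    {k : Fin J} (hk : partialD M.g k x ≠ 0) : M.g x / partialD M.g k x = eulerSum m k x := by
  have heuler := fderiv_self_of_homogeneous hD hM.structural.homogeneous hx
    (hM.differentiableAt hD hx)
  rw [fderiv_apply_eq_sum_partialD (hM.differentiableAt hD hx)] at heuler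
  rw [eulerSum, ← heuler, ← Finset.add_sum_erase _ _ (Finset.mem_univ k), add_div,
    mul_div_cancel_left₀ _ hk, Finset.sum_div]
  congr 1
  refine Finset.sum_congr rfl fun l _ => ?_
  rw [← hm.ratio_eq hD hM hx, ratio]
  ring

/-- The factor `∂_k g` cancels between numerator and denominator; where `g x = 0` both sides are `0`
by the convention for division. -/
lemma IsRegression.logGrad_eq {M : Model J Rbar D Ω 𝒱} (hD : IsOpen D)
    (hM : M.Assumptions) {m : Cov J → ℝ} (hm : M.IsRegression m) {x : Cov J} (hx : x ∈ D)
    {k : Fin J} (hk : partialD M.g k x ≠ 0) (j : Fin J) :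
    logGrad m k j x = partialD M.g j x / M.g x := by
  rw [logGrad, ← hm.div_partialD_eq_eulerSum hD hM hx hk, ← hm.ratio_eq hD hM hx, ratio,
    div_div_div_cancel_right₀ hk]

/-- The structural function is identified up to scale. -/
lemma exists_scale_of_observedLaw_eq (M : Model J Rbar D Ω 𝒱) (hD : IsOpen D)
    (hDc : IsConnected D) (hM : M.Assumptions) {Ω' : Type*} [MeasurableSpace Ω']
    [StandardBorelSpace Ω'] {𝒱' : Type*} [MeasurableSpace 𝒱'] (M' : Model J Rbar D Ω' 𝒱')
    (hM' : M'.Assumptions) (hlaw : M'.observedLaw = M.observedLaw) :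
    ∃ c : ℝ, 0 < c ∧ ∀ x ∈ D, M'.g x = c * M.g x := by
  obtain ⟨k, hk⟩ := hM.structural.partial_ne_zero
  have hreg' := M.isRegression_meanResponse_of_observedLaw_eq hD hM M' hM'.honest hlaw
  -- Both models have the same `∇m`, equal to the mean weight times the gradient of the structural
  -- function, which dictates this ratio.
  set L : Cov J → ℝ := fun x => M.meanWeight x / M'.meanWeight x with hL
  have hfd : ∀ x ∈ D, fderiv ℝ M'.g x = L x • fderiv ℝ M.g x := by
    intro x hx
    have h := (hreg'.hasFDerivAt hD hM' hx).unique (M.hasFDerivAt_meanResponse hD hM hx)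
    rw [hL]
    simp only
    rw [div_eq_inv_mul, mul_smul, ← h, smul_smul, inv_mul_cancel₀ (M'.meanWeight_pos hM' hx).ne',
      one_smul]
  have hval : ∀ x ∈ D, M'.g x = L x * M.g x := by
    intro x hx
    rw [← fderiv_self_of_homogeneous hD hM'.structural.homogeneous hx (hM'.differentiableAt hD hx),
      ← fderiv_self_of_homogeneous hD hM.structural.homogeneous hx (hM.differentiableAt hD hx),
      hfd x hx]
    rfl
  have hconst := exists_const_of_fderiv_eq_smul hD hDc hM.structural.contDiff
    hM'.structural.contDiff k hk hfd hval
  obtain ⟨x₀, hx₀⟩ := hDc.nonempty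
  refine ⟨L x₀, div_pos (M.meanWeight_pos hM hx₀) (M'.meanWeight_pos hM' hx₀), fun x hx => ?_⟩
  rw [hval x hx, hconst x hx x₀ hx₀]

end Model

end OrderedResponse

end

theorem proposition2 {J Rbar : ℕ} {D : Set (OrderedResponse.Cov J)}
    (hDo : IsOpen D) (hDc : IsConnected D)
    {Ω : Type*} [MeasurableSpace Ω] [StandardBorelSpace Ω] {𝒱 : Type*} [MeasurableSpace 𝒱]
    (M : OrderedResponse.Model J Rbar D Ω 𝒱) (hM : M.Assumptions) :
    -- the regression function `m(x) = E[R|X = x]` exists on `D`, is unique and differentiable there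
    (∃ m, M.IsRegression m) ∧
    (∀ m m', M.IsRegression m → M.IsRegression m' → EqOn m m' D) ∧
    (∀ m, M.IsRegression m → ∀ x ∈ D, DifferentiableAt ℝ m x) ∧
    -- formulas for `g` in terms of ratios of its partial derivatives
    (∀ m, M.IsRegression m → ∀ k : Fin J, (∀ x ∈ D, OrderedResponse.partialD M.g k x ≠ 0) →
      (∀ x ∈ D, OrderedResponse.partialD m k x ≠ 0) ∧
      (∀ x ∈ D, ∀ j : Fin J, OrderedResponse.ratio M.g k j x = OrderedResponse.ratio m k j x) ∧
      (∀ x ∈ D, M.g x / OrderedResponse.partialD M.g k x = OrderedResponse.eulerSum m k x) ∧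
      (∀ a x : OrderedResponse.Cov J, ∀ γ γ' : ℝ → OrderedResponse.Cov J,
        OrderedResponse.IsPath (D ∩ {y | M.g y ≠ 0}) a x γ γ' →
        IntervalIntegrable (fun t => ∑ j, OrderedResponse.logGrad m k j (γ t) * γ' t j)
          volume 0 1 ∧
        M.g x = M.g a *
          Real.exp (∫ t in (0 : ℝ)..1, ∑ j, OrderedResponse.logGrad m k j (γ t) * γ' t j)) ∧
      (∀ a x : OrderedResponse.Cov J,
        (∀ j : Fin J, ∀ t ∈ uIcc (a j) (x j),
          OrderedResponse.stair a x j t ∈ D ∩ {y | M.g y ≠ 0}) →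
        (∀ j : Fin J, IntervalIntegrable
          (fun t => OrderedResponse.logGrad m k j (OrderedResponse.stair a x j t))
          volume (a j) (x j)) ∧
        M.g x = M.g a *
          Real.exp (∑ j, ∫ t in (a j)..(x j),
            OrderedResponse.logGrad m k j (OrderedResponse.stair a x j t)))) ∧
    -- any model with the same distribution of `(R, X)` has the same `g` up to scale
    (∀ {Ω' : Type*} [MeasurableSpace Ω'] [StandardBorelSpace Ω']
      {𝒱' : Type*} [MeasurableSpace 𝒱'] (M' : OrderedResponse.Model J Rbar D Ω' 𝒱'),
      M'.Assumptions → M'.observedLaw = M.observedLaw →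
        ∃ c : ℝ, 0 < c ∧ ∀ x ∈ D, M'.g x = c * M.g x) := by
  refine ⟨⟨_, M.isRegression_meanResponse hDo hM⟩, fun m m' hm hm' => hm.eqOn hDo hM.fullSupport hm',
    fun m hm x hx => (hm.hasFDerivAt hDo hM hx).differentiableAt, ?_,
    fun M' hM' hlaw => M.exists_scale_of_observedLaw_eq hDo hDc hM M' hM' hlaw⟩
  intro m hm k hk
  have hlog : ∀ x ∈ D, ∀ j, OrderedResponse.logGrad m k j x =
      OrderedResponse.partialD M.g j x / M.g x :=
    fun x hx j => hm.logGrad_eq hDo hM hx (hk x hx) j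
  refine ⟨fun x hx => ?_, fun x hx j => hm.ratio_eq hDo hM hx k j,
    fun x hx => hm.div_partialD_eq_eulerSum hDo hM hx (hk x hx), ?_, ?_⟩
  · rw [hm.partialD_eq hDo hM hx]
    exact mul_ne_zero (M.meanWeight_pos hM hx).ne' (hk x hx)
  · intro a x γ γ' hγ
    obtain ⟨s, hs, hd⟩ := hγ.hasDerivAt
    have hI : uIcc (0 : ℝ) 1 = Icc 0 1 := uIcc_of_le zero_le_one
    have h := OrderedResponse.eq_mul_exp_integral_logDeriv hDo hM.structural.contDiff
      (γ := γ) (γ' := γ') (a := 0) (b := 1) (by rw [hI]; exact hγ.mem)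
      (by rw [hI]; exact hγ.continuousOn) hs
      (by rw [min_eq_left zero_le_one, max_eq_right zero_le_one]; exact hd) hγ.integrable
    rw [hγ.source, hγ.target] at h
    have hcongr : ∀ t ∈ uIcc (0 : ℝ) 1,
        ∑ j, OrderedResponse.partialD M.g j (γ t) / M.g (γ t) * γ' t j =
          ∑ j, OrderedResponse.logGrad m k j (γ t) * γ' t j := fun t ht =>
      Finset.sum_congr rfl fun j _ => by rw [hlog _ (hγ.mem t (hI ▸ ht)).1]
    refine ⟨h.1.congr fun t ht => hcongr t (uIoc_subset_uIcc ht), ?_⟩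
    rw [h.2, intervalIntegral.integral_congr hcongr]
  · intro a x hmem
    have h := OrderedResponse.eq_mul_exp_sum_integral_stair hDo hM.structural.contDiff hmem
    have hcongr : ∀ j, ∀ t ∈ uIcc (a j) (x j),
        OrderedResponse.partialD M.g j (OrderedResponse.stair a x j t) /
          M.g (OrderedResponse.stair a x j t) =
        OrderedResponse.logGrad m k j (OrderedResponse.stair a x j t) := fun j t ht =>
      (hlog _ (hmem j t ht).1 j).symm
    refine ⟨fun j => (h.1 j).congr fun t ht => hcongr j t (uIoc_subset_uIcc ht), ?_⟩
    rw [h.2]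
    congr 2
    exact Finset.sum_congr rfl fun j _ => intervalIntegral.integral_congr (hcongr j)
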